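/- Let $\mathcal H$ and $\mathcal V$ be real Hilbert spaces, with $\mathcal V$ densely and continuously embedded into $\mathcal H$; write $\mathcal V\hookrightarrow\mathcal H=\mathcal H'\hookrightarrow\mathcal V'$ and let $\langle\cdot,\cdot\rangle$ be the duality pairing between $\mathcal V'$ and $\mathcal V$. Let $U=\prod_{j=1}^J U_j$, where each $U_j$ is a closed subspace of $L^2(X_j,\mu_j)^{N_j}$ for a finite measure space $(X_j,\mu_j)$, and let $I_U:\mathcal V\to U$ be linear and continuous. Let $g_j:\mathbb R^{N_j}\to\mathbb R^{N_j}$ be continuous with $(g_j(x)-g_j(y))\cdot(x-y)\ge 0$, $g_j(0)=0$ and $|g_j(x)|\le M(1+|x|)$ for all $x,y$, for some constant $M>0$. Let $\alpha_j:[0,\infty)\times X_j\to(0,\infty)$ satisfy $\alpha_j(t,x)=\alpha(t)$ for all $t\ge 0$, $x\in X_j$ and all $j$, where $\alpha\in C^1([0,\infty);(0,\infty))$ and $\alpha'$ is Lipschitz on $[0,T]$ for every $T>0$. Define $B(t):\mathcal V\to\mathcal V'$ and $B_1:\mathcal V\to\mathcal V'$ by $$\langle B(t)u,v\rangle=\sum_{j=1}^J\int_{X_j}\alpha_j(t,x)\,g_j((I_Uu)_j(x))\cdot(I_Uv)_j(x)\,d\mu_j(x),\qquad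 \langle B_1u,v\rangle=\sum_{j=1}^J\int_{X_j}g_j((I_Uu)_j(x))\cdot(I_Uv)_j(x)\,d\mu_j(x),$$ so that $B(t)=\alpha(t)B_1$. Let $A_1:\mathcal V\to\mathcal V'$ be linear and bounded. For each operator $F:\mathcal V\to\mathcal V'$ considered below, we regard $F$ as an operator in $\mathcal H$ with domain $\{v\in\mathcal V: Fv\in\mathcal H\}$; in particular $\mathcal A_B(t)=A_1+B(t)$ has domain $D(\mathcal A_B(t))=\{v\in\mathcal V:(A_1+B(t))v\in\mathcal H\}$. Assume that, as an operator in $\mathcal H$, $A_1+B_1$ has dense domain and is maximal quasi-monotone, i.e. $A_1+B_1+\omega\,\mathbb I$ is maximal monotone for some $\omega\ge 0$. Assume moreover that there exist $D\in C^1([0,\infty);\mathcal L(\mathcal H))$ and $\tilde D\in C([0,\infty);\mathcal L(\mathcal H))$ such that $D'$ and $\tilde D$ are Lipschitz on $[0,T]$ for every $T>0$; for all $t\ge 0$, $D(t)$ and $\tilde D(t)$ are invertible in $\mathcal L(\mathcal H)$ and $D(t)\tilde D(t)$ is symmetric positive definite; for every $T>0$ there is $c_T>0$ with $$(\tilde D(t)^{-1}D(t)^{-1}x,x)_{\mathcal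 H}\ge c_T\|x\|_{\mathcal H}^2\qquad\forall x\in\mathcal H,\ t\in[0,T];$$ and, as an equality of operators in $\mathcal H$ (including equality of domains), $$(A_1+\alpha(t)B_1)D(t)^{-1}=\tilde D(t)(A_1+B_1)\qquad\forall t\ge 0.$$ Then for every $x_0\in D(\mathcal A_B(0))$ there is a unique function $x\in C([0,\infty);\mathcal H)$ with $x(0)=x_0$ such that $x(t)\in D(\mathcal A_B(t))$ for all $t\ge 0$ and such that, for all $t\ge 0$ outside a countable set, the strong derivative $x'(t)$ exists in $\mathcal H$, $x'(t)=-\mathcal A_B(t)x(t)$, and $s\mapsto\mathcal A_B(s)x(s)$ is continuous at $t$ (at $t=0$ the derivative is one-sided). -/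

import Mathlib

open Set MeasureTheory

noncomputable section

namespace HyperbolicFeedback

section Operators

variable {V H : Type*} [NormedAddCommGroup H] [InnerProductSpace ℝ H]

/-- The part in `H` of the (possibly nonlinear) operator `V → V'` with pairing `F u v = ⟨F u, v⟩`,
given through its graph. Here `ι` embeds `V` into `H`, and `F v ∈ H` with value `h` means that
`⟨F v, w⟩ = (h, w)_H` for all `w` in `V`. The domain of the operator is `{v ∈ V | F v ∈ H}`. -/
def partInH (ι : V → H) (F : V → V → ℝ) : Set (H × H) :=
  {p | ∃ v : V, ι v = p.1 ∧ ∀ w : V, F v w = inner ℝ p.2 (ι w)}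

/-- `partInH ι F` is the graph of a single-valued operator when `ι` is injective with dense
range. -/
theorem partInH_singleValued {ι : V → H} (hι : Function.Injective ι) (hd : DenseRange ι)
    {F : V → V → ℝ} {u h k : H} (hh : (u, h) ∈ partInH ι F) (hk : (u, k) ∈ partInH ι F) :
    h = k := by
  obtain ⟨v, hv, hv2⟩ := hh
  obtain ⟨v', hv', hv2'⟩ := hk
  obtain rfl : v = v' := hι (hv.trans hv'.symm)
  refine hd.eq_of_inner_left ℝ ?_
  intro w
  exact (hv2 w).symm.trans (hv2' w)

/-- The domain of an operator in `H` given by its graph. -/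
def operatorDomain (G : Set (H × H)) : Set H :=
  {u | ∃ z : H, (u, z) ∈ G}

/-- Monotonicity of an operator in `H` given by its graph. -/
def IsMonotoneGraph (G : Set (H × H)) : Prop :=
  ∀ p ∈ G, ∀ q ∈ G, 0 ≤ inner ℝ (p.2 - q.2) (p.1 - q.1)

/-- Maximal monotonicity: a monotone graph without proper monotone extension. -/
def IsMaximalMonotone (G : Set (H × H)) : Prop :=
  IsMonotoneGraph G ∧ ∀ G' : Set (H × H), IsMonotoneGraph G' → G ⊆ G' → G' = G

/-- The operator with graph `G` is maximal quasi-monotone: adding `ω` times the identity makes it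
maximal monotone, for some `ω ≥ 0`. -/
def IsMaximalQuasiMonotone (G : Set (H × H)) : Prop :=
  ∃ ω : ℝ, 0 ≤ ω ∧ IsMaximalMonotone {p : H × H | (p.1, p.2 - ω • p.1) ∈ G}

/-- `x` solves `x'(t) + 𝒜(t) x(t) = 0` for `t ≥ 0`, `x(0) = x₀`, where `G t` is the graph of `𝒜(t)`:
`x` is continuous from `[0, ∞)` to `H`, `x(t)` lies in the domain of `𝒜(t)` for all `t ≥ 0`
(with `z t = 𝒜(t) x(t)`), and, except at countably many `t`, the strong derivative
`x'(t) = -𝒜(t) x(t)` exists and is continuous. -/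
def IsSolution (G : ℝ → Set (H × H)) (x₀ : H) (x : ℝ → H) : Prop :=
  ContinuousOn x (Ici 0) ∧ x 0 = x₀ ∧
    ∃ z : ℝ → H, (∀ t, 0 ≤ t → (x t, z t) ∈ G t) ∧
      ∃ N : Set ℝ, N.Countable ∧ ∀ t, 0 ≤ t → t ∉ N →
        HasDerivWithinAt x (-z t) (Ici 0) t ∧ ContinuousWithinAt z (Ici 0) t

end Operators

/-- Lipschitz continuity on every interval `[0, T]`. -/
def LocallyLipschitzInTime {E : Type*} [NormedAddCommGroup E] (f : ℝ → E) : Prop :=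
  ∀ T : ℝ, 0 < T → ∃ ν : ℝ, 0 < ν ∧
    ∀ s ∈ Icc 0 T, ∀ t ∈ Icc 0 T, ‖f t - f s‖ ≤ ν * |t - s|

section Damping

variable {V : Type*} [NormedAddCommGroup V] [NormedSpace ℝ V]
  {J : ℕ} {X : Fin J → Type*} [∀ j, MeasurableSpace (X j)] {μ : ∀ j, Measure (X j)}
  {N : Fin J → ℕ} {U : ∀ j, Submodule ℝ (Lp (EuclideanSpace ℝ (Fin (N j))) 2 (μ j))}

/-- The pairing
`⟨B u, v⟩ = ∑ j, ∫ a_j(x) g_j((I_U u)_j(x)) · (I_U v)_j(x) dμ_j(x)` with weights `a_j`. -/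
def dampingPairing (IU : V →L[ℝ] (∀ j, U j))
    (g : ∀ j, EuclideanSpace ℝ (Fin (N j)) → EuclideanSpace ℝ (Fin (N j)))
    (a : ∀ j, X j → ℝ) (u v : V) : ℝ :=
  ∑ j, ∫ x, a j x *
    inner ℝ (g j ((IU u j : Lp (EuclideanSpace ℝ (Fin (N j))) 2 (μ j)) x))
      ((IU v j : Lp (EuclideanSpace ℝ (Fin (N j))) 2 (μ j)) x) ∂(μ j)

end Damping

end HyperbolicFeedback

end

open HyperbolicFeedback

open Filter Topology

/-! The substitution `y = D(t) x` removes the time dependence from the nonlinear operator. Write `A`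
for the part of `A₁ + B₁` in `H`. The commutation hypothesis says that the operator at time `t`
equals `D̃(t) A D(t)`, so `x' = -𝒜(t) x` becomes `y' = Q(t) y - P(t) z` with `z ∈ (A + ω) y`, `P = D
D̃` and `Q = D' D⁻¹ + ω D D̃`. The maximal monotone operator `A + ω` and its domain are now fixed in
time, and only bounded linear factors, Lipschitz on compact time intervals, vary.

The factor `P(t)` spoils monotonicity in the norm of `H`, but not in the energy `(K(t) u, u)` with
`K = P⁻¹`, which is symmetric and coercive: `(K P (z₁ - z₂), y₁ - y₂) = (z₁ - z₂, y₁ - y₂) ≥ 0`.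
Every estimate combines this identity (`inner_velocity_sub_le`) with Gronwall's inequality for the
energy (`energy_gronwall`), applied to differences of two solutions, or of a solution and its time
translate.

Existence follows Kato's scheme. Minty's theorem supplies Yosida approximations, whose equations are
ordinary differential equations. Energy estimates bound `y` and `z` uniformly in the Yosida
parameter and make `y` Cauchy. Demiclosedness of the graph identifies the weak limit of `z`, giving
a locally Lipschitz solution whose velocity is weakly continuous (`exists_weakSolution`).

Strong regularity comes from the energy of the velocity. Up to an exponential factor and a linear
term it is nonincreasing, hence continuous off a countable set; weak continuity together with
continuity of this norm is strong continuity (`exists_countable`). Uniqueness is Gronwall again, in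
a form that tolerates a countable exceptional set (`le_of_upper_dini_nonpos`). -/

namespace HyperbolicFeedback

/-! ### Maximal monotone operators: Minty's theorem, Yosida approximation, demiclosedness. -/

section Minty

variable {E : Type*} [NormedAddCommGroup E] [InnerProductSpace ℝ E] [CompleteSpace E]

/-- The function `r + ‖p‖² / 2` attains its minimum on a closed convex set of pairs `(p, r)` on which
it is bounded below, and the minimiser satisfies the first order optimality condition. -/
theorem exists_minimizer_add_half_norm_sq {C : Set (E × ℝ)} (hc : IsClosed C) (hconv : Convex ℝ C)
    (hne : C.Nonempty) {b : ℝ} (hb : ∀ p ∈ C, b ≤ p.2 + ‖p.1‖ ^ 2 / 2) :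
    ∃ p₀ ∈ C, ∀ p ∈ C, 0 ≤ p.2 - p₀.2 + inner ℝ p₀.1 (p.1 - p₀.1) := by
  set val : E × ℝ → ℝ := fun p => p.2 + ‖p.1‖ ^ 2 / 2 with hval
  set m := sInf (val '' C) with hm
  have hbdd : BddBelow (val '' C) := ⟨b, by rintro _ ⟨p, hp, rfl⟩; exact hb p hp⟩
  have hmle : ∀ p ∈ C, m ≤ val p := fun p hp => csInf_le hbdd ⟨p, hp, rfl⟩
  have hseq : ∀ n : ℕ, ∃ p ∈ C, val p < m + 1 / ((n : ℝ) + 1) := by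
    intro n
    have : m < m + 1 / ((n : ℝ) + 1) := by
      have : (0 : ℝ) < 1 / ((n : ℝ) + 1) := by positivity
      linarith
    obtain ⟨_, ⟨p, hp, rfl⟩, h⟩ := exists_lt_of_csInf_lt (hne.image val) this
    exact ⟨p, hp, h⟩
  choose p hpC hpv using hseq
  -- The midpoint of `a` and `d` lies in `C`, and by the parallelogram law its value falls below the
  -- average by `‖a.1 - d.1‖² / 8`. Hence the first components of a minimising sequence are Cauchy.
  have hmid : ∀ a ∈ C, ∀ d ∈ C, ‖a.1 - d.1‖ ^ 2 / 8 ≤ (val a + val d) / 2 - m := by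
    intro a ha d hd
    have h1 := hmle _ (hconv ha hd (by norm_num : (0 : ℝ) ≤ 1 / 2) (by norm_num : (0 : ℝ) ≤ 1 / 2)
      (by norm_num))
    simp only [hval, Prod.snd_add, Prod.smul_snd, Prod.fst_add, Prod.smul_fst, smul_eq_mul] at h1 ⊢
    rw [← smul_add, norm_smul] at h1
    have h2 := parallelogram_law_with_norm ℝ a.1 d.1
    norm_num at h1
    nlinarith
  have hcauchy : CauchySeq (fun n => (p n).1) := by
    rw [Metric.cauchySeq_iff']
    intro ε hε
    obtain ⟨n, hn⟩ := exists_nat_one_div_lt (show (0 : ℝ) < ε ^ 2 / 8 by positivity)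
    refine ⟨n, fun k hk => ?_⟩
    rw [dist_eq_norm]
    have h1 := hmid _ (hpC k) _ (hpC n)
    have h2 := hpv k
    have h3 := hpv n
    have h4 : 1 / ((k : ℝ) + 1) ≤ 1 / ((n : ℝ) + 1) := Nat.one_div_le_one_div hk
    refine lt_of_pow_lt_pow_left₀ 2 hε.le ?_
    linarith
  obtain ⟨x, hx⟩ := cauchySeq_tendsto_of_complete hcauchy
  have hvl : Tendsto (fun n => val (p n)) atTop (𝓝 m) := by
    refine tendsto_of_tendsto_of_tendsto_of_le_of_le tendsto_const_nhds
      (h := fun n : ℕ => m + 1 / ((n : ℝ) + 1)) ?_ (fun n => hmle _ (hpC n)) (fun n => (hpv n).le)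
    simpa using tendsto_one_div_add_atTop_nhds_zero_nat.const_add m
  have hr : Tendsto (fun n => (p n).2) atTop (𝓝 (m - ‖x‖ ^ 2 / 2)) := by
    have := hvl.sub ((hx.norm.pow 2).div_const 2)
    refine this.congr fun n => ?_
    simp [hval]
  have hmem : (x, m - ‖x‖ ^ 2 / 2) ∈ C :=
    hc.mem_of_tendsto (hx.prodMk_nhds hr) (Eventually.of_forall hpC)
  refine ⟨_, hmem, fun q hq => ?_⟩
  set r := m - ‖x‖ ^ 2 / 2
  -- Minimality along the segment towards `q`, divided by `t`; the quadratic term disappears as `t →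
  -- 0`.
  have key : ∀ t : ℝ, t ∈ Ioo (0 : ℝ) 1 →
      0 ≤ (q.2 - r + inner ℝ x (q.1 - x)) + t * (‖q.1 - x‖ ^ 2 / 2) := by
    intro t ht
    have h1 := hmle _ (hconv.add_smul_sub_mem hmem hq ⟨ht.1.le, ht.2.le⟩)
    simp only [hval, Prod.snd_add, Prod.smul_snd, Prod.fst_add, Prod.smul_fst, smul_eq_mul,
      Prod.fst_sub, Prod.snd_sub] at h1
    rw [norm_add_sq_real, norm_smul, inner_smul_right, mul_pow, Real.norm_eq_abs, sq_abs] at h1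
    have : 0 ≤ t * ((q.2 - r + inner ℝ x (q.1 - x)) + t * (‖q.1 - x‖ ^ 2 / 2)) := by
      simp only [r] at h1 ⊢
      nlinarith
    exact nonneg_of_mul_nonneg_right this ht.1
  have hlim : Tendsto (fun t : ℝ => (q.2 - r + inner ℝ x (q.1 - x)) + t * (‖q.1 - x‖ ^ 2 / 2))
      (𝓝[>] 0) (𝓝 ((q.2 - r + inner ℝ x (q.1 - x)) + 0 * (‖q.1 - x‖ ^ 2 / 2))) := by
    refine Tendsto.mono_left ?_ nhdsWithin_le_nhds
    exact (Continuous.tendsto (by fun_prop) 0)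
  rw [zero_mul, add_zero] at hlim
  exact ge_of_tendsto hlim (by
    filter_upwards [Ioo_mem_nhdsGT (zero_lt_one : (0 : ℝ) < 1)] with t ht using key t ht)

variable {H : Type*} [NormedAddCommGroup H] [InnerProductSpace ℝ H]

theorem IsMaximalMonotone.mem_of_forall {G : Set (H × H)} (hG : IsMaximalMonotone G) {x u : H}
    (h : ∀ q ∈ G, 0 ≤ inner ℝ (u - q.2) (x - q.1)) : (x, u) ∈ G := by
  have hins : IsMonotoneGraph (insert (x, u) G) := by
    rintro p (rfl | hp) q (rfl | hq)
    · simp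
    · exact h q hq
    · have := h p hp
      rw [← neg_sub u, ← neg_sub x, inner_neg_neg]
      exact this
    · exact hG.1 p hp q hq
  rw [← hG.2 _ hins (subset_insert _ _)]
  exact mem_insert _ _

variable [CompleteSpace H]

/-- Fitzpatrick's argument. The function `F(x, u) = sup_{q ∈ G} ((x, q₂) + (q₁, u) - (q₁, q₂))` is
convex, dominates `(x, u)` by maximality, and is at most `(x, u)` on `G` by monotonicity. The
minimiser of `F + ‖·‖² / 2` on `H × H` then yields the required point of the graph. -/
theorem exists_neg_mem_of_maximal {G : Set (H × H)} (hmono : IsMonotoneGraph G)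
    (hmax : ∀ x u : H, (∀ q ∈ G, 0 ≤ inner ℝ (u - q.2) (x - q.1)) → (x, u) ∈ G) :
    ∃ x : H, (x, -x) ∈ G := by
  -- The epigraph of the Fitzpatrick function; working with it avoids infinite values of the
  -- supremum.
  set C : Set (WithLp 2 (H × H) × ℝ) :=
    {p | ∀ q ∈ G, inner ℝ p.1.fst q.2 + inner ℝ q.1 p.1.snd - inner ℝ q.1 q.2 ≤ p.2} with hC
  have hclosed : IsClosed C := by
    have : C = ⋂ q ∈ G, {p : WithLp 2 (H × H) × ℝ |
        inner ℝ p.1.fst q.2 + inner ℝ q.1 p.1.snd - inner ℝ q.1 q.2 ≤ p.2} := by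
      ext p; simp [hC]
    rw [this]
    refine isClosed_biInter fun q _ => isClosed_le ?_ continuous_snd
    have h1 : Continuous fun p : WithLp 2 (H × H) × ℝ => p.1.fst :=
      (WithLp.prod_continuous_ofLp 2 H H).fst.comp continuous_fst
    have h2 : Continuous fun p : WithLp 2 (H × H) × ℝ => p.1.snd :=
      (WithLp.prod_continuous_ofLp 2 H H).snd.comp continuous_fst
    fun_prop
  have hconv : Convex ℝ C := by
    intro p hp q hq a b ha hb hab v hv
    have h1 := mul_le_mul_of_nonneg_left (hp v hv) ha
    have h2 := mul_le_mul_of_nonneg_left (hq v hv) hb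
    simp only [Prod.fst_add, Prod.smul_fst, Prod.snd_add, Prod.smul_snd, WithLp.add_fst,
      WithLp.add_snd, WithLp.smul_fst, WithLp.smul_snd, inner_add_left, inner_add_right,
      inner_smul_left, inner_smul_right, smul_eq_mul, RCLike.conj_to_real]
    have h3 : (inner ℝ v.1 v.2 : ℝ) = a * inner ℝ v.1 v.2 + b * inner ℝ v.1 v.2 := by
      rw [← add_mul, hab, one_mul]
    rw [h3]
    linarith
  obtain ⟨q₀, hq₀⟩ : G.Nonempty := by
    by_contra hne
    rw [Set.not_nonempty_iff_eq_empty] at hne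
    have := hmax 0 0 (by simp [hne])
    simp [hne] at this
  have hgraph : ∀ q ∈ G, (WithLp.toLp 2 q, (inner ℝ q.1 q.2 : ℝ)) ∈ C := by
    intro p hp q hq
    have := hmono p hp q hq
    simp only [inner_sub_left, inner_sub_right] at this
    change inner ℝ p.1 q.2 + inner ℝ q.1 p.2 - inner ℝ q.1 q.2 ≤ inner ℝ p.1 p.2
    rw [real_inner_comm q.2 p.1, real_inner_comm p.2 q.1, real_inner_comm q.2 q.1,
      real_inner_comm p.2 p.1]
    linarith
  -- If the inequality failed, the point would be monotonically related to all of `G`, hence in `G`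
  -- by maximality; testing membership in `C` against the point itself is then contradictory.
  have hfitz : ∀ p ∈ C, inner ℝ p.1.fst p.1.snd ≤ p.2 := by
    intro p hp
    by_contra hlt
    rw [not_le] at hlt
    have hmem : (p.1.fst, p.1.snd) ∈ G := by
      refine hmax _ _ fun q hq => ?_
      have := hp q hq
      simp only [inner_sub_left, inner_sub_right]
      rw [real_inner_comm p.1.fst, real_inner_comm q.1 p.1.snd, real_inner_comm p.1.fst q.2,
        real_inner_comm q.1 q.2]
      linarith
    have := hp _ hmem
    simp only at this
    linarith
  have hnn : ∀ p ∈ C, (0 : ℝ) ≤ p.2 + ‖p.1‖ ^ 2 / 2 := by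
    intro p hp
    have h1 := hfitz p hp
    rw [WithLp.prod_norm_sq_eq_of_L2]
    have h2 := norm_add_sq_real p.1.fst p.1.snd
    have h3 := sq_nonneg ‖p.1.fst + p.1.snd‖
    linarith
  obtain ⟨⟨p₀, r₀⟩, hp₀, hopt⟩ :=
    exists_minimizer_add_half_norm_sq hclosed hconv ⟨_, hgraph q₀ hq₀⟩ hnn
  have hf := hfitz _ hp₀
  -- Optimality tested at graph points shows that `(-p₀.snd, -p₀.fst)` is monotonically related to
  -- `G` with a margin. Being in `G`, it can itself serve as `q`, which forces the margin to vanish.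
  have hineq : ∀ q ∈ G, ‖p₀.fst + p₀.snd‖ ^ 2 ≤
      inner ℝ (-p₀.fst - q.2) (-p₀.snd - q.1) := by
    intro q hq
    have h1 := hopt _ (hgraph q hq)
    simp only [inner_sub_right, WithLp.prod_inner_apply] at h1
    simp only [inner_sub_left, inner_sub_right, inner_neg_left, inner_neg_right]
    rw [norm_add_sq_real]
    rw [real_inner_comm p₀.snd q.2, real_inner_comm q.1 q.2]
    simp only at hf
    change 0 ≤ inner ℝ q.1 q.2 - r₀ + (inner ℝ p₀.fst q.1 + inner ℝ p₀.snd q.2 -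
      (inner ℝ p₀.fst p₀.fst + inner ℝ p₀.snd p₀.snd)) at h1
    rw [real_inner_self_eq_norm_sq, real_inner_self_eq_norm_sq] at h1
    linarith
  have hmem : (-p₀.snd, -p₀.fst) ∈ G :=
    hmax _ _ fun q hq => (sq_nonneg _).trans (hineq q hq)
  have h0 := hineq _ hmem
  simp only [sub_self, inner_zero_left] at h0
  have h1 : p₀.fst + p₀.snd = 0 := by
    rw [← norm_eq_zero, ← sq_eq_zero_iff]
    exact le_antisymm h0 (sq_nonneg _)
  have h2 : p₀.fst = -p₀.snd := eq_neg_of_add_eq_zero_left h1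
  exact ⟨-p₀.snd, by rw [← h2] at hmem ⊢; exact hmem⟩

/-- Minty's theorem: the resolvents of a maximal monotone operator are everywhere defined. -/
theorem IsMaximalMonotone.exists_resolvent {G : Set (H × H)} (hG : IsMaximalMonotone G) {l : ℝ}
    (hl : 0 < l) (w : H) : ∃ x : H, (x, l⁻¹ • (w - x)) ∈ G := by
  have hl' : 0 < l⁻¹ := inv_pos.2 hl
  -- The graph is rescaled by `l` and shifted by `w`; this preserves maximal monotonicity, and its
  -- points `(x, -x)` are the solutions of the resolvent equation.
  obtain ⟨x, hx⟩ := exists_neg_mem_of_maximal (G := {p : H × H | (p.1, l⁻¹ • (p.2 + w)) ∈ G})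
    (by
      intro p hp q hq
      have := hG.1 _ hp _ hq
      simp only [← smul_sub, inner_smul_left, RCLike.conj_to_real, add_sub_add_right_eq_sub] at this
      exact nonneg_of_mul_nonneg_right this hl')
    (by
      intro x u h
      refine hG.mem_of_forall fun q hq => ?_
      have := h (q.1, l • q.2 - w) (by
        simpa only [mem_ofPred_eq, sub_add_cancel, smul_smul, inv_mul_cancel₀ hl.ne', one_smul]
          using hq)
      have h2 : l⁻¹ • (u + w) - q.2 = l⁻¹ • (u - (l • q.2 - w)) := by
        rw [smul_sub, smul_sub, smul_smul, inv_mul_cancel₀ hl.ne', smul_add]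
        simp only [one_smul]; abel
      rw [h2, inner_smul_left]
      exact mul_nonneg hl'.le this)
  refine ⟨x, ?_⟩
  have : (x, l⁻¹ • (-x + w)) ∈ G := hx
  rwa [neg_add_eq_sub] at this

/-- The Yosida approximation `a` of a maximal monotone operator, characterised by
`a x ∈ A (x - l a x)`. -/
theorem IsMaximalMonotone.exists_yosida {G : Set (H × H)} (hG : IsMaximalMonotone G) {l : ℝ}
    (hl : 0 < l) : ∃ a : H → H, (∀ x, (x - l • a x, a x) ∈ G) ∧
      (∀ x y, ‖a x - a y‖ ≤ l⁻¹ * ‖x - y‖) ∧ (∀ x y, 0 ≤ inner ℝ (a x - a y) (x - y)) ∧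
      ∀ x u, (x, u) ∈ G → ‖a x‖ ≤ ‖u‖ := by
  choose r hr using fun w => hG.exists_resolvent hl w
  have hmem : ∀ x, (x - l • (l⁻¹ • (x - r x)), l⁻¹ • (x - r x)) ∈ G := by
    intro x
    rw [smul_smul, mul_inv_cancel₀ hl.ne', one_smul, sub_sub_cancel]
    exact hr x
  -- Cocoercivity of the Yosida approximation: monotonicity of `G` at the resolvent points. Both the
  -- Lipschitz bound and monotonicity follow from it.
  have key : ∀ x y, l * ‖l⁻¹ • (x - r x) - l⁻¹ • (y - r y)‖ ^ 2 ≤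
      inner ℝ (l⁻¹ • (x - r x) - l⁻¹ • (y - r y)) (x - y) := by
    intro x y
    have h := hG.1 _ (hmem x) _ (hmem y)
    have h2 : x - l • (l⁻¹ • (x - r x)) - (y - l • (l⁻¹ • (y - r y))) =
        (x - y) - l • (l⁻¹ • (x - r x) - l⁻¹ • (y - r y)) := by
      rw [smul_sub l]; abel
    simp only [h2] at h
    rw [inner_sub_right, inner_smul_right, real_inner_self_eq_norm_sq] at h
    linarith
  refine ⟨fun x => l⁻¹ • (x - r x), hmem, fun x y => ?_, fun x y => ?_, fun x u hu => ?_⟩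
  · have h1 := (key x y).trans (real_inner_le_norm _ _)
    rw [inv_mul_eq_div, le_div_iff₀ hl]
    rcases (norm_nonneg (l⁻¹ • (x - r x) - l⁻¹ • (y - r y))).eq_or_lt with h0 | h0
    · simp only [← h0]; simp
    · nlinarith
  · exact (mul_nonneg hl.le (sq_nonneg _)).trans (key x y)
  · have h := hG.1 _ (hmem x) _ hu
    have h2 : x - l • (l⁻¹ • (x - r x)) - x = -(l • (l⁻¹ • (x - r x))) := by abel
    simp only at h
    rw [h2, inner_neg_right, inner_smul_right, inner_sub_left, real_inner_self_eq_norm_sq] at h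
    have h3 : ‖l⁻¹ • (x - r x)‖ ^ 2 ≤ inner ℝ u (l⁻¹ • (x - r x)) := by
      by_contra hc
      nlinarith
    have h4 := h3.trans (real_inner_le_norm _ _)
    rcases (norm_nonneg (l⁻¹ • (x - r x))).eq_or_lt with h0 | h0
    · rw [← h0]; exact norm_nonneg _
    · nlinarith

/-- Bounded families have weak limits along ultrafilters. -/
theorem exists_weak_limit_ultrafilter {β : Type*} (F : Ultrafilter β) {z : β → H} {C : ℝ}
    (hz : ∀ᶠ n in (F : Filter β), ‖z n‖ ≤ C) :
    ∃ v : H, ‖v‖ ≤ C ∧ ∀ w, Tendsto (fun n => (inner ℝ (z n) w : ℝ)) F (𝓝 (inner ℝ v w)) := by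
  have hC : 0 ≤ C := by
    obtain ⟨n, hn⟩ := hz.exists
    exact (norm_nonneg _).trans hn
  have hlim : ∀ w : H, ∃ a : ℝ, Tendsto (fun n => (inner ℝ (z n) w : ℝ)) F (𝓝 a) := by
    intro w
    have hcomp : IsCompact (Icc (-(C * ‖w‖)) (C * ‖w‖)) := isCompact_Icc
    obtain ⟨a, -, ha⟩ := hcomp.ultrafilter_le_nhds' (F.map fun n => (inner ℝ (z n) w : ℝ)) (by
      rw [Ultrafilter.mem_map]
      filter_upwards [hz] with n hn
      have := abs_real_inner_le_norm (z n) w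
      exact abs_le.1 (this.trans (by gcongr)))
    exact ⟨a, ha⟩
  choose f hf using hlim
  have hbound : ∀ w, ‖f w‖ ≤ C * ‖w‖ := by
    intro w
    refine le_of_tendsto (hf w).norm ?_
    filter_upwards [hz] with n hn
    exact (norm_inner_le_norm _ _).trans (by gcongr)
  let ℓ : H →ₗ[ℝ] ℝ :=
    { toFun := f
      map_add' := fun v w => tendsto_nhds_unique (hf (v + w)) (by
        simpa only [inner_add_right] using (hf v).add (hf w))
      map_smul' := fun c w => tendsto_nhds_unique (hf (c • w)) (by
        simpa only [inner_smul_right, RingHom.id_apply, smul_eq_mul] using (hf w).const_mul c) }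
  let ℓ' : StrongDual ℝ H := ℓ.mkContinuous C hbound
  refine ⟨(InnerProductSpace.toDual ℝ H).symm ℓ', ?_, fun w => ?_⟩
  · rw [LinearIsometryEquiv.norm_map]
    exact ℓ.mkContinuous_norm_le hC hbound
  · rw [InnerProductSpace.toDual_symm_apply]
    exact hf w

/-- A single-valued maximal monotone operator is demiclosed. -/
theorem IsMaximalMonotone.demiclosed {G : Set (H × H)} (hG : IsMaximalMonotone G)
    (hsv : ∀ x u v, (x, u) ∈ G → (x, v) ∈ G → u = v) {β : Type*} {F : Filter β} [F.NeBot]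
    {x z : β → H} {a : H} {C : ℝ} (hmem : ∀ᶠ n in F, (x n, z n) ∈ G) (hx : Tendsto x F (𝓝 a))
    (hz : ∀ᶠ n in F, ‖z n‖ ≤ C) :
    ∃ v : H, (a, v) ∈ G ∧ ‖v‖ ≤ C ∧ ∀ w, Tendsto (fun n => (inner ℝ (z n) w : ℝ)) F (𝓝 (inner ℝ v w)) := by
  have key : ∀ U : Ultrafilter β, (U : Filter β) ≤ F → ∃ v : H, (a, v) ∈ G ∧ ‖v‖ ≤ C ∧
      ∀ w, Tendsto (fun n => (inner ℝ (z n) w : ℝ)) U (𝓝 (inner ℝ v w)) := by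
    intro U hU
    obtain ⟨v, hvC, hv⟩ := exists_weak_limit_ultrafilter U (hz.filter_mono hU)
    refine ⟨v, hG.mem_of_forall fun q hq => ?_, hvC, hv⟩
    -- Strong convergence of `x` paired with weak convergence of the bounded `z` lets the
    -- monotonicity inequality pass to the limit.
    have h1 : Tendsto (fun n => (inner ℝ (z n - q.2) (x n - q.1) : ℝ)) U
        (𝓝 (inner ℝ (v - q.2) (a - q.1))) := by
      have h2 : Tendsto (fun n => (inner ℝ (z n) (x n - a) : ℝ)) U (𝓝 0) := by
        have h3 : Tendsto (fun n => C * ‖x n - a‖) U (𝓝 0) := by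
          have := ((tendsto_iff_norm_sub_tendsto_zero.1 hx).mono_left hU).const_mul C
          rwa [mul_zero] at this
        refine squeeze_zero_norm' ?_ h3
        filter_upwards [hz.filter_mono hU] with n hn
        exact (norm_inner_le_norm _ _).trans (by gcongr)
      have h4 : Tendsto (fun n => (inner ℝ q.2 (x n - q.1) : ℝ)) U (𝓝 (inner ℝ q.2 (a - q.1))) :=
        tendsto_const_nhds.inner ((hx.mono_left hU).sub_const _)
      have := (h2.add (hv (a - q.1))).sub h4
      rw [zero_add, ← inner_sub_left] at this
      refine this.congr fun n => ?_
      rw [← inner_add_right, inner_sub_left]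
      congr 2
      abel
    refine ge_of_tendsto h1 ?_
    filter_upwards [hmem.filter_mono hU] with n hn using hG.1 _ hn _ hq
  obtain ⟨v, hv, hvC, -⟩ := key (Ultrafilter.of F) (Ultrafilter.of_le F)
  refine ⟨v, hv, hvC, fun w => ?_⟩
  -- Weak limits along different ultrafilters coincide because all of them are values of `G` at `a`.
  rw [tendsto_iff_ultrafilter]
  intro U hU
  obtain ⟨v', hv', -, h⟩ := key U hU
  rw [hsv _ _ _ hv hv']
  exact h w

end Minty

/-! ### Dini derivatives and Gronwall's inequality with a countable exceptional set. -/

section Dini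

/-- A continuous function whose upper right Dini derivative is nonpositive off a countable set
is nonincreasing. -/
theorem le_of_upper_dini_nonpos {F : ℝ → ℝ} {a b : ℝ} (hab : a ≤ b)
    (hc : ContinuousOn F (Icc a b)) {N : Set ℝ} (hN : N.Countable)
    (h : ∀ t ∈ Ico a b, t ∉ N → ∀ ε > 0, ∀ᶠ s in 𝓝[>] t, F s - F t ≤ (s - t) * ε) :
    F b ≤ F a := by
  by_contra! hlt
  have hab' : a < b := lt_of_le_of_ne hab (by rintro rfl; exact lt_irrefl _ hlt)
  have hba : 0 < b - a := sub_pos.2 hab'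
  -- Half the mean slope, so that subtracting `δ (t - a)` still leaves a function that increases
  -- from `a` to `b`.
  set δ := (F b - F a) / (2 * (b - a)) with hδ
  have hδ0 : 0 < δ := div_pos (sub_pos.2 hlt) (by positivity)
  set G : ℝ → ℝ := fun t => F t - δ * (t - a) with hGdef
  have hGc : ContinuousOn G (Icc a b) := hc.sub (by fun_prop)
  have hGab : G a < G b := by
    have : δ * (b - a) = (F b - F a) / 2 := by rw [hδ]; field_simp
    simp only [hGdef, sub_self, mul_zero, sub_zero, this]
    linarith
  -- For each intermediate level `y`, the last time at which `G ≤ y`.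
  have hT : ∀ y ∈ Ioo (G a) (G b), ∃ t ∈ Ico a b, G t = y ∧ ∀ s ∈ Ioc t b, y < G s := by
    intro y hy
    have hcomp : IsCompact (Icc a b ∩ G ⁻¹' Iic y) :=
      isCompact_Icc.of_isClosed_subset (hGc.preimage_isClosed_of_isClosed isClosed_Icc isClosed_Iic)
        inter_subset_left
    obtain ⟨t, ⟨ht, hty⟩, hgr⟩ :=
      hcomp.exists_isGreatest ⟨a, left_mem_Icc.2 hab, hy.1.le⟩
    have htb : t < b := lt_of_le_of_ne ht.2 (by
      rintro rfl
      exact absurd hy.2 (not_lt.2 hty))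
    refine ⟨t, ⟨ht.1, htb⟩, ?_, fun s hs => ?_⟩
    · obtain ⟨s, hs, hsy⟩ := intermediate_value_Icc htb.le
        (hGc.mono (Icc_subset_Icc_left ht.1)) ⟨hty, hy.2.le⟩
      have : s ≤ t := hgr ⟨⟨ht.1.trans hs.1, hs.2⟩, hsy.le⟩
      rw [← hsy, le_antisymm this hs.1]
    · by_contra! hle
      exact absurd (hgr ⟨⟨ht.1.trans hs.1.le, hs.2⟩, hle⟩) (not_le.2 hs.1)
  choose! T hTab hTy hTgt using hT
  -- Just after `T y` the function `G` exceeds `y`, which violates the Dini bound with `ε = δ`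
  -- unless `T y ∈ N`. Since `T` is injective, a whole interval of levels would be countable.
  have hmaps : MapsTo T (Ioo (G a) (G b)) N := by
    intro y hy
    by_contra hn
    have h1 := h _ (hTab y hy) hn δ hδ0
    have h2 : ∀ᶠ s in 𝓝[>] (T y), s ∈ Ioc (T y) b := Ioc_mem_nhdsGT (hTab y hy).2
    obtain ⟨s, hs1, hs2⟩ := (h1.and h2).exists
    have h3 := hTgt y hy s hs2
    have h4 := hTy y hy
    simp only [hGdef] at h3 h4
    nlinarith
  have hinj : InjOn T (Ioo (G a) (G b)) := by
    intro y hy y' hy' he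
    rw [← hTy y hy, ← hTy y' hy', he]
  have hcount := hmaps.countable_of_injOn hinj hN
  have := hcount.measure_zero volume
  rw [Real.volume_Ioo, ENNReal.ofReal_eq_zero] at this
  linarith

theorem eventually_sub_le_of_hasDerivWithinAt {f : ℝ → ℝ} {f' t ε : ℝ}
    (h : HasDerivWithinAt f f' (Ioi t) t) (hε : 0 < ε) :
    ∀ᶠ s in 𝓝[>] t, f s - f t ≤ (s - t) * (f' + ε) := by
  have h1 := (hasDerivWithinAt_iff_tendsto_slope' (by simp)).1 h
  filter_upwards [h1.eventually (gt_mem_nhds (show f' < f' + ε by linarith)),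
    self_mem_nhdsWithin] with s hs hst
  have hst' : 0 < s - t := sub_pos.2 hst
  rw [slope_def_field, div_lt_iff₀ hst'] at hs
  linarith

theorem gronwall_of_upper_dini {F : ℝ → ℝ} {a b C B : ℝ} (hab : a ≤ b) (hC : 0 ≤ C) (hB : 0 ≤ B)
    (hc : ContinuousOn F (Icc a b)) {N : Set ℝ} (hN : N.Countable)
    (h : ∀ t ∈ Ico a b, t ∉ N → ∀ ε > 0,
      ∀ᶠ s in 𝓝[>] t, F s - F t ≤ (s - t) * (C * F t + B + ε)) :
    F b ≤ Real.exp (C * (b - a)) * (F a + B * (b - a)) := by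
  set e : ℝ → ℝ := fun t => Real.exp (-(C * (t - a))) with he
  have hec : Continuous e := by fun_prop
  have hed : ∀ t, HasDerivAt e (-(C * e t)) t := by
    intro t
    have h1 : HasDerivAt (fun t : ℝ => -(C * (t - a))) (-(C * 1)) t :=
      (((hasDerivAt_id t).sub_const a).const_mul C).neg
    convert h1.exp using 1
    simp only [he]; ring
  -- The integrating factor `e` absorbs `C F`; since `e ≤ 1` on the interval, subtracting `B (t -
  -- a)` absorbs the constant term.
  have key := le_of_upper_dini_nonpos (F := fun t => e t * F t - B * (t - a)) hab
    ((hec.continuousOn.mul hc).sub (by fun_prop)) hN (by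
      intro t ht htN ε hε
      have hε4 : 0 < ε / 4 := by positivity
      have he1 : e t ≤ 1 := Real.exp_le_one_iff.2
        (neg_nonpos.2 (mul_nonneg hC (sub_nonneg.2 ht.1)))
      have h1 := h t ht htN (ε / 4) hε4
      have h2 := eventually_sub_le_of_hasDerivWithinAt
        ((hed t).mul_const (F t)).hasDerivWithinAt hε4
      have h3 : ∀ᶠ s in 𝓝[>] t, e s * (C * F t + B + ε / 4) <
          e t * (C * F t + B + ε / 4) + ε / 4 := by
        have h4 : Tendsto (fun s => e s * (C * F t + B + ε / 4)) (𝓝[>] t)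
            (𝓝 (e t * (C * F t + B + ε / 4))) :=
          (Continuous.tendsto (by fun_prop) t).mono_left nhdsWithin_le_nhds
        exact h4.eventually (gt_mem_nhds (by linarith))
      filter_upwards [h1, h2, h3, self_mem_nhdsWithin] with s h1 h2 h3 hs
      have hst : 0 < s - t := sub_pos.2 hs
      have hes : 0 < e s := Real.exp_pos _
      have h5 := mul_le_mul_of_nonneg_left h1 hes.le
      have h6 := mul_le_mul_of_nonneg_left h3.le hst.le
      have h7 : e t * (C * F t + B + ε / 4) ≤ C * e t * F t + B + ε / 4 := by nlinarith
      have h8 := mul_le_mul_of_nonneg_left h7 hst.le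
      nlinarith)
  simp only [he, sub_self, mul_zero, neg_zero, Real.exp_zero, one_mul, sub_zero] at key
  have h1 : Real.exp (C * (b - a)) * Real.exp (-(C * (b - a))) = 1 := by
    rw [← Real.exp_add]; simp
  have h2 : 1 ≤ Real.exp (C * (b - a)) := Real.one_le_exp (mul_nonneg hC (sub_nonneg.2 hab))
  have h3 : Real.exp (-(C * (b - a))) * F b ≤ F a + B * (b - a) := by linarith
  have h4 := mul_le_mul_of_nonneg_left h3 (Real.exp_pos (C * (b - a))).le
  rwa [← mul_assoc, h1, one_mul] at h4

end Dini

/-! ### Weak right derivatives and time-dependent quadratic energies. -/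

section Energy

variable {H : Type*} [NormedAddCommGroup H] [InnerProductSpace ℝ H]

/-- `u` is Lipschitz at `t` from the right, with weak right derivative `f`. -/
def HasWeakRightDeriv (u : ℝ → H) (f : H) (t : ℝ) : Prop :=
  (∃ L, ∀ᶠ s in 𝓝[>] t, ‖u s - u t‖ ≤ L * (s - t)) ∧
    ∀ w, HasDerivWithinAt (fun s => (inner ℝ (u s) w : ℝ)) (inner ℝ f w) (Ioi t) t

theorem HasWeakRightDeriv.sub {u v : ℝ → H} {f g : H} {t : ℝ} (hu : HasWeakRightDeriv u f t)
    (hv : HasWeakRightDeriv v g t) : HasWeakRightDeriv (fun s => u s - v s) (f - g) t := by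
  obtain ⟨⟨L, hL⟩, hu⟩ := hu
  obtain ⟨⟨L', hL'⟩, hv⟩ := hv
  refine ⟨⟨L + L', ?_⟩, fun w => ?_⟩
  · filter_upwards [hL, hL'] with s h h'
    rw [sub_sub_sub_comm, add_mul]
    exact (norm_sub_le _ _).trans (add_le_add h h')
  · simp only [inner_sub_left]
    exact (hu w).sub (hv w)

theorem HasWeakRightDeriv.sub_const {u : ℝ → H} {f : H} {t : ℝ} (hu : HasWeakRightDeriv u f t)
    (x : H) : HasWeakRightDeriv (fun s => u s - x) f t := by
  obtain ⟨⟨L, hL⟩, hu⟩ := hu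
  refine ⟨⟨L, by simpa using hL⟩, fun w => ?_⟩
  simpa only [inner_sub_left] using (hu w).sub_const (inner ℝ x w)

theorem tendsto_add_const_nhdsGT (t h : ℝ) : Tendsto (fun s => s + h) (𝓝[>] t) (𝓝[>] (t + h)) := by
  refine tendsto_nhdsWithin_iff.2 ⟨?_, ?_⟩
  · exact (Continuous.tendsto (by fun_prop) t).mono_left nhdsWithin_le_nhds
  · filter_upwards [self_mem_nhdsWithin] with s hs
    exact add_lt_add_left hs h

theorem HasWeakRightDeriv.comp_add_const {u : ℝ → H} {f : H} {t h : ℝ}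
    (hu : HasWeakRightDeriv u f (t + h)) : HasWeakRightDeriv (fun s => u (s + h)) f t := by
  obtain ⟨⟨L, hL⟩, hu⟩ := hu
  refine ⟨⟨L, ?_⟩, fun w => ?_⟩
  · filter_upwards [(tendsto_add_const_nhdsGT t h).eventually hL] with s hs
    rwa [add_sub_add_right_eq_sub] at hs
  · have h1 := (hu w).scomp t (((hasDerivAt_id t).add_const h).hasDerivWithinAt (s := Ioi t))
      (fun s hs => add_lt_add_left hs h)
    rw [one_smul] at h1
    exact h1

theorem _root_.HasDerivWithinAt.hasWeakRightDeriv {u : ℝ → H} {f : H} {t : ℝ}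
    (hu : HasDerivWithinAt u f (Ioi t) t) : HasWeakRightDeriv u f t := by
  refine ⟨?_, fun w => ?_⟩
  · obtain ⟨L, hL⟩ := hu.isBigO_sub.bound
    refine ⟨L, ?_⟩
    rw [prod_pure, eventually_map] at hL
    filter_upwards [hL, self_mem_nhdsWithin] with s hs hst
    rwa [Real.norm_eq_abs, abs_of_pos (sub_pos.2 hst)] at hs
  · simpa using hu.inner ℝ (hasDerivWithinAt_const t (Ioi t) w)

theorem HasWeakRightDeriv.tendsto {u : ℝ → H} {f : H} {t : ℝ} (hu : HasWeakRightDeriv u f t) :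
    Tendsto u (𝓝[>] t) (𝓝 (u t)) := by
  obtain ⟨⟨L, hL⟩, -⟩ := hu
  rw [tendsto_iff_norm_sub_tendsto_zero]
  refine squeeze_zero' (Eventually.of_forall fun _ => norm_nonneg _) hL ?_
  have : Tendsto (fun s => L * (s - t)) (𝓝 t) (𝓝 (L * (t - t))) :=
    Continuous.tendsto (by fun_prop) t
  rw [sub_self, mul_zero] at this
  exact this.mono_left nhdsWithin_le_nhds

/-- Upper right Dini derivative of the energy `(K(s) u(s), u(s))`, for Lipschitz symmetric `K`. -/
theorem HasWeakRightDeriv.energy {u : ℝ → H} {f : H} {t : ℝ} (hu : HasWeakRightDeriv u f t)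
    {K : ℝ → H →L[ℝ] H} {l : ℝ} (hl : ∀ s, ‖K s - K t‖ ≤ l * |s - t|)
    (hsym : ∀ x y, (inner ℝ (K t x) y : ℝ) = inner ℝ x (K t y)) {ε : ℝ} (hε : 0 < ε) :
    ∀ᶠ s in 𝓝[>] t, (inner ℝ (K s (u s)) (u s) : ℝ) - inner ℝ (K t (u t)) (u t) ≤
      (s - t) * (l * ‖u t‖ ^ 2 + 2 * inner ℝ (K t f) (u t) + ε) := by
  have htend := hu.tendsto
  obtain ⟨⟨L, hL⟩, hw⟩ := hu
  have h1 := eventually_sub_le_of_hasDerivWithinAt (hw (K t (u t))) (show 0 < ε / 4 by positivity)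
  have h2 : ∀ᶠ s in 𝓝[>] t, l * ‖u s‖ ^ 2 + ‖K t‖ * L ^ 2 * (s - t) < l * ‖u t‖ ^ 2 + ε / 2 := by
    have h3 : Tendsto (fun s => l * ‖u s‖ ^ 2 + ‖K t‖ * L ^ 2 * (s - t)) (𝓝[>] t)
        (𝓝 (l * ‖u t‖ ^ 2 + ‖K t‖ * L ^ 2 * (t - t))) :=
      ((htend.norm.pow 2).const_mul l).add
        ((Continuous.tendsto (by fun_prop) t).mono_left nhdsWithin_le_nhds)
    exact h3.eventually (gt_mem_nhds (by simp; positivity))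
  filter_upwards [h1, h2, hL, self_mem_nhdsWithin] with s h1 h2 hL hs
  have hst : 0 < s - t := sub_pos.2 hs
  -- Exact expansion into the variation of `K`, a linear term tested against the fixed vector `K t
  -- (u t)`, where the weak derivative suffices, and a quadratic remainder, which is `O((s - t)²)`
  -- by the Lipschitz bound.
  have e1 : (inner ℝ (K s (u s)) (u s) : ℝ) - inner ℝ (K t (u t)) (u t) =
      inner ℝ ((K s - K t) (u s)) (u s) + 2 * (inner ℝ (u s) (K t (u t)) - inner ℝ (u t) (K t (u t)))
        + inner ℝ (K t (u s - u t)) (u s - u t) := by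
    simp only [sub_apply, map_sub, inner_sub_left, inner_sub_right]
    rw [hsym (u t) (u s), hsym (u t) (u t), hsym (u s) (u t),
      real_inner_comm (K t (u s)) (u t), hsym (u s) (u t)]
    ring
  have e2 : (inner ℝ ((K s - K t) (u s)) (u s) : ℝ) ≤ l * (s - t) * ‖u s‖ ^ 2 := by
    refine (real_inner_le_norm _ _).trans ?_
    have := (K s - K t).le_of_opNorm_le (hl s) (u s)
    rw [abs_of_pos hst] at this
    nlinarith [norm_nonneg (u s)]
  have e3 : (inner ℝ (K t (u s - u t)) (u s - u t) : ℝ) ≤ ‖K t‖ * (L * (s - t)) ^ 2 := by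
    refine (real_inner_le_norm _ _).trans ?_
    have h5 := (K t).le_opNorm (u s - u t)
    calc ‖K t (u s - u t)‖ * ‖u s - u t‖ ≤ ‖K t‖ * ‖u s - u t‖ * ‖u s - u t‖ := by gcongr
      _ = ‖K t‖ * ‖u s - u t‖ ^ 2 := by ring
      _ ≤ _ := by gcongr
  have e4 : (inner ℝ (K t f) (u t) : ℝ) = inner ℝ f (K t (u t)) := hsym _ _
  rw [e1, e4]
  have h6 := mul_le_mul_of_nonneg_left h2.le hst.le
  nlinarith

end Energy

/-! ### Global Lipschitz differential equations by an exponentially weighted fixed point. -/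

section GlobalODE

variable {E : Type*} [NormedAddCommGroup E] [NormedSpace ℝ E]

theorem exp_neg_mul_norm_integral_le {g : ℝ → E} {k D : ℝ} (hk : 0 < k) (hD : 0 ≤ D)
    (hg : ∀ s, 0 ≤ s → ‖g s‖ ≤ D * Real.exp (2 * k * s)) {t : ℝ} (ht : 0 ≤ t) :
    Real.exp (-(2 * k * t)) * ‖∫ s in (0 : ℝ)..t, g s‖ ≤ D / (2 * k) := by
  have hk2 : 0 < 2 * k := by positivity
  have h1 : ‖∫ s in (0 : ℝ)..t, g s‖ ≤ ∫ s in (0 : ℝ)..t, D * Real.exp (2 * k * s) :=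
    intervalIntegral.norm_integral_le_of_norm_le ht
      (Eventually.of_forall fun s hs => hg s hs.1.le) (by
        apply Continuous.intervalIntegrable; fun_prop)
  have h2 : ∫ s in (0 : ℝ)..t, D * Real.exp (2 * k * s) =
      D / (2 * k) * Real.exp (2 * k * t) - D / (2 * k) * Real.exp (2 * k * 0) := by
    refine intervalIntegral.integral_eq_sub_of_hasDerivAt (f := fun s => D / (2 * k) *
      Real.exp (2 * k * s)) (fun s _ => ?_) (by apply Continuous.intervalIntegrable; fun_prop)
    have h3 : HasDerivAt (fun s : ℝ => 2 * k * s) (2 * k * 1) s := (hasDerivAt_id s).const_mul _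
    refine (h3.exp.const_mul (D / (2 * k))).congr_deriv ?_
    field_simp
  rw [h2, mul_zero, Real.exp_zero, mul_one] at h1
  have h4 : Real.exp (-(2 * k * t)) * Real.exp (2 * k * t) = 1 := by rw [← Real.exp_add]; simp
  have h5 : 0 ≤ D / (2 * k) := by positivity
  calc Real.exp (-(2 * k * t)) * ‖∫ s in (0 : ℝ)..t, g s‖
      ≤ Real.exp (-(2 * k * t)) * (D / (2 * k) * Real.exp (2 * k * t)) := by
        gcongr; linarith
    _ = D / (2 * k) * (Real.exp (-(2 * k * t)) * Real.exp (2 * k * t)) := by ring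
    _ = D / (2 * k) := by rw [h4, mul_one]

variable [CompleteSpace E]

/-- Global existence for ordinary differential equations with globally Lipschitz right-hand
side. -/
theorem exists_forall_hasDerivAt_of_lipschitz {f : ℝ → E → E} {k B : ℝ} (hk : 0 < k)
    (hf : Continuous (Function.uncurry f)) (hlip : ∀ t x y, ‖f t x - f t y‖ ≤ k * ‖x - y‖)
    (hB : ∀ t, ‖f t 0‖ ≤ B) (x₀ : E) :
    ∃ y : ℝ → E, y 0 = x₀ ∧ Continuous y ∧ ∀ t, 0 ≤ t → HasDerivAt y (f t (y t)) t := by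
  have hB0 : 0 ≤ B := (norm_nonneg _).trans (hB 0)
  -- The unknown is `u(t) = exp(-2kt) y(t)` in the supremum norm. With this weight the Picard map
  -- contracts with factor `k / (2k) = 1/2` on all of `[0, ∞)` at once; `max t 0` below extends
  -- functions constantly to negative times.
  let g : BoundedContinuousFunction ℝ E → ℝ → E := fun u s => f s (Real.exp (2 * k * s) • u s)
  have hgc : ∀ u, Continuous (g u) := fun u =>
    hf.comp (continuous_id.prodMk (by
      have := u.continuous
      fun_prop))
  let I : BoundedContinuousFunction ℝ E → ℝ → E := fun u t => x₀ + ∫ s in (0 : ℝ)..t, g u s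
  have hId : ∀ u t, HasDerivAt (I u) (g u t) t := fun u t =>
    ((hgc u).integral_hasStrictDerivAt 0 t).hasDerivAt.const_add x₀
  have hIc : ∀ u, Continuous (I u) := fun u =>
    continuous_iff_continuousAt.2 fun t => (hId u t).continuousAt
  have hgdiff : ∀ u v s, ‖g u s - g v s‖ ≤ k * ‖u - v‖ * Real.exp (2 * k * s) := by
    intro u v s
    refine (hlip _ _ _).trans ?_
    rw [← smul_sub, norm_smul, Real.norm_eq_abs, Real.abs_exp,
      mul_comm (Real.exp (2 * k * s)), ← mul_assoc]
    have := (u - v).norm_coe_le_norm s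
    rw [BoundedContinuousFunction.sub_apply] at this
    gcongr
  have hg0 : ∀ u s, 0 ≤ s → ‖g u s‖ ≤ (B + k * ‖u‖) * Real.exp (2 * k * s) := by
    intro u s hs
    have h1 := hgdiff u 0 s
    rw [sub_zero] at h1
    have h2 : ‖g 0 s‖ ≤ B := by simpa [g] using hB s
    have h3 : 1 ≤ Real.exp (2 * k * s) := Real.one_le_exp (by positivity)
    have h4 : ‖g u s‖ ≤ ‖g u s - g 0 s‖ + ‖g 0 s‖ := norm_le_norm_sub_add _ _
    nlinarith
  have hΦb : ∀ u t, ‖Real.exp (-(2 * k * max t 0)) • I u (max t 0)‖ ≤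
      ‖x₀‖ + (B + k * ‖u‖) / (2 * k) := by
    intro u t
    have ht : 0 ≤ max t 0 := le_max_right _ _
    have h1 := exp_neg_mul_norm_integral_le hk (by positivity) (hg0 u) ht
    have h2 : Real.exp (-(2 * k * max t 0)) ≤ 1 :=
      Real.exp_le_one_iff.2 (neg_nonpos.2 (by positivity))
    rw [norm_smul, Real.norm_eq_abs, Real.abs_exp]
    calc _ ≤ Real.exp (-(2 * k * max t 0)) * (‖x₀‖ + ‖∫ s in (0 : ℝ)..(max t 0), g u s‖) := by
          gcongr; exact norm_add_le _ _
      _ ≤ _ := by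
          rw [mul_add]
          refine add_le_add ?_ h1
          exact mul_le_of_le_one_left (norm_nonneg _) h2
  let Φ : BoundedContinuousFunction ℝ E → BoundedContinuousFunction ℝ E := fun u =>
    BoundedContinuousFunction.ofNormedAddCommGroup
      (fun t => Real.exp (-(2 * k * max t 0)) • I u (max t 0))
      (by
        have := hIc u
        fun_prop) _ (hΦb u)
  have hΦ : ContractingWith (1 / 2) Φ := by
    refine ⟨by norm_num, LipschitzWith.of_dist_le_mul fun u v => ?_⟩
    rw [BoundedContinuousFunction.dist_le (by positivity)]
    intro t
    have ht : 0 ≤ max t 0 := le_max_right _ _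
    have h1 := exp_neg_mul_norm_integral_le hk (by positivity)
      (g := fun s => g u s - g v s) (fun s _ => hgdiff u v s) ht
    rw [intervalIntegral.integral_sub ((hgc u).intervalIntegrable _ _)
      ((hgc v).intervalIntegrable _ _)] at h1
    change dist (Real.exp (-(2 * k * max t 0)) • I u (max t 0))
      (Real.exp (-(2 * k * max t 0)) • I v (max t 0)) ≤ _
    rw [dist_eq_norm, ← smul_sub, norm_smul, Real.norm_eq_abs, Real.abs_exp, dist_eq_norm]
    simp only [I, add_sub_add_left_eq_sub]
    refine h1.trans (le_of_eq ?_)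
    push_cast
    field_simp
  set u := ContractingWith.fixedPoint Φ hΦ
  have hu : Φ u = u := hΦ.fixedPoint_isFixedPt
  refine ⟨I u, by simp [I], hIc u, fun t ht => ?_⟩
  convert hId u t using 1
  have h1 : Real.exp (-(2 * k * max t 0)) • I u (max t 0) = u t :=
    congrArg (fun w : BoundedContinuousFunction ℝ E => w t) hu
  rw [max_eq_left ht] at h1
  simp only [g]
  rw [← h1, smul_smul, ← Real.exp_add, add_neg_cancel, Real.exp_zero, one_smul]

end GlobalODE

/-! ### The evolution equation with bounded coefficients: uniform estimates for Yosida solutions. -/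

section Evolution

variable {H : Type*} [NormedAddCommGroup H] [InnerProductSpace ℝ H]

/-- Bounds for the coefficients of the evolution equation `y' = Q(t) y - P(t) A y`: all operators are
bounded and Lipschitz in time with constant `M`, and `K(t)` is a symmetric left inverse of `P(t)`,
coercive with constant `c`. -/
structure EvolutionCoefficients (P Q K : ℝ → H →L[ℝ] H) (M c : ℝ) : Prop where
  M_nonneg : 0 ≤ M
  c_pos : 0 < c
  P_le : ∀ t, ‖P t‖ ≤ M
  Q_le : ∀ t, ‖Q t‖ ≤ M
  K_le : ∀ t, ‖K t‖ ≤ M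
  P_lip : ∀ s t, ‖P s - P t‖ ≤ M * |s - t|
  Q_lip : ∀ s t, ‖Q s - Q t‖ ≤ M * |s - t|
  K_lip : ∀ s t, ‖K s - K t‖ ≤ M * |s - t|
  symm : ∀ t x y, (inner ℝ (K t x) y : ℝ) = inner ℝ x (K t y)
  coercive : ∀ t x, c * ‖x‖ ^ 2 ≤ inner ℝ (K t x) x
  left_inv : ∀ t x, K t (P t x) = x

/-- The velocity `Q(t) y - P(t) z`. -/
def velocity (P Q : ℝ → H →L[ℝ] H) (t : ℝ) (y z : H) : H := Q t y - P t z

theorem continuous_of_norm_sub_le {E : Type*} [NormedAddCommGroup E] {f : ℝ → E} {M : ℝ}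
    (h : ∀ s t, ‖f s - f t‖ ≤ M * |s - t|) : Continuous f := by
  refine LipschitzWith.continuous (K := M.toNNReal) (LipschitzWith.of_dist_le_mul fun s t => ?_)
  rw [dist_eq_norm, dist_eq_norm, Real.norm_eq_abs]
  exact (h s t).trans (by gcongr; exact Real.le_coe_toNNReal M)

namespace EvolutionCoefficients

variable {P Q K : ℝ → H →L[ℝ] H} {M c : ℝ} (h : EvolutionCoefficients P Q K M c)

include h

theorem continuous_P : Continuous P := continuous_of_norm_sub_le h.P_lip

theorem continuous_Q : Continuous Q := continuous_of_norm_sub_le h.Q_lip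

theorem continuous_K : Continuous K := continuous_of_norm_sub_le h.K_lip

theorem norm_velocity_le (t : ℝ) (y z : H) : ‖velocity P Q t y z‖ ≤ M * (‖y‖ + ‖z‖) := by
  rw [mul_add]
  exact (norm_sub_le _ _).trans (add_le_add ((Q t).le_of_opNorm_le (h.Q_le t) y)
    ((P t).le_of_opNorm_le (h.P_le t) z))

/-- Since `K P = 1`, `z = K (Q y - velocity)`, so a bound on the velocity is a bound on `z`. -/
theorem norm_le_velocity (t : ℝ) (y z : H) : ‖z‖ ≤ M * (‖velocity P Q t y z‖ + M * ‖y‖) := by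
  have h1 : z = K t (Q t y - velocity P Q t y z) := by
    rw [velocity, sub_sub_cancel, h.left_inv]
  calc ‖z‖ = ‖K t (Q t y - velocity P Q t y z)‖ := by rw [← h1]
    _ ≤ M * ‖Q t y - velocity P Q t y z‖ := (K t).le_of_opNorm_le (h.K_le t) _
    _ ≤ M * (‖velocity P Q t y z‖ + M * ‖y‖) := by
        have := h.M_nonneg
        gcongr
        rw [add_comm]
        exact (norm_sub_le _ _).trans (by gcongr; exact (Q t).le_of_opNorm_le (h.Q_le t) y)

theorem energy_le (t : ℝ) (x : H) : (inner ℝ (K t x) x : ℝ) ≤ M * ‖x‖ ^ 2 := by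
  refine (real_inner_le_norm _ _).trans ?_
  rw [pow_two, ← mul_assoc]
  gcongr
  exact (K t).le_of_opNorm_le (h.K_le t) x

/-- Applying `K t` turns `P t (z₁ - z₂)` into `z₁ - z₂`, so monotonicity acts directly and only
Lipschitz perturbations remain. Two distinct times are allowed in order to treat increments in time;
`e` measures the defect of monotonicity, which is nonzero when Yosida solutions with different
parameters are compared. -/
theorem inner_velocity_sub_le (s t : ℝ) {x₁ z₁ x₂ z₂ : H} {e : ℝ}
    (he : -inner ℝ (z₁ - z₂) (x₁ - x₂) ≤ e) :
    (inner ℝ (K t (velocity P Q s x₁ z₁ - velocity P Q t x₂ z₂)) (x₁ - x₂) : ℝ) ≤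
      e + M ^ 2 * ‖x₁ - x₂‖ ^ 2 + M ^ 2 * |s - t| * (‖z₁‖ + ‖x₁‖) * ‖x₁ - x₂‖ := by
  have hM := h.M_nonneg
  have h1 : K t (velocity P Q s x₁ z₁ - velocity P Q t x₂ z₂) =
      K t ((Q s - Q t) x₁) + K t (Q t (x₁ - x₂)) - K t ((P s - P t) z₁) - (z₁ - z₂) := by
    rw [← h.left_inv t (z₁ - z₂), ← map_add, ← map_sub, ← map_sub]
    congr 1
    simp only [velocity, sub_apply, map_sub]
    abel
  have hK : ∀ (x : H) (r : ℝ), ‖x‖ ≤ r → |(inner ℝ (K t x) (x₁ - x₂) : ℝ)| ≤ M * r * ‖x₁ - x₂‖ := by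
    intro x r hr
    refine (abs_real_inner_le_norm _ _).trans ?_
    gcongr
    exact ((K t).le_of_opNorm_le (h.K_le t) x).trans (by gcongr)
  have h2 := le_of_abs_le (hK _ _ ((Q s - Q t).le_of_opNorm_le (h.Q_lip s t) x₁))
  have h3 := le_of_abs_le (hK _ _ ((Q t).le_of_opNorm_le (h.Q_le t) (x₁ - x₂)))
  have h4 := neg_le_of_abs_le (hK _ _ ((P s - P t).le_of_opNorm_le (h.P_lip s t) z₁))
  rw [h1, inner_sub_left, inner_sub_left, inner_add_left]
  linarith

/-- Gronwall's inequality for the energy `(K u, u)`. -/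
theorem energy_gronwall {u : ℝ → H} {a b C B : ℝ} (hab : a ≤ b) (hC : 0 ≤ C) (hB : 0 ≤ B)
    (hu : ContinuousOn u (Icc a b)) {N : Set ℝ} (hN : N.Countable)
    (hd : ∀ t ∈ Ico a b, t ∉ N → ∃ f, HasWeakRightDeriv u f t ∧
      2 * inner ℝ (K t f) (u t) ≤ C * ‖u t‖ ^ 2 + B) :
    (inner ℝ (K b (u b)) (u b) : ℝ) ≤
      Real.exp ((M + C) / c * (b - a)) * (inner ℝ (K a (u a)) (u a) + B * (b - a)) := by
  have hM := h.M_nonneg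
  have hc := h.c_pos
  refine gronwall_of_upper_dini (F := fun t => (inner ℝ (K t (u t)) (u t) : ℝ)) hab
    (by positivity) hB ((h.continuous_K.continuousOn.clm_apply hu).inner hu) hN ?_
  intro t ht htN ε hε
  obtain ⟨f, hf, hle⟩ := hd t ht htN
  filter_upwards [hf.energy (fun s => h.K_lip s t) (h.symm t) hε, self_mem_nhdsWithin]
    with s hs hst
  refine hs.trans (mul_le_mul_of_nonneg_left ?_ (sub_pos.2 hst).le)
  have h1 : (M + C) * ‖u t‖ ^ 2 ≤ (M + C) / c * inner ℝ (K t (u t)) (u t) := by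
    rw [div_mul_eq_mul_div, le_div_iff₀ hc, mul_assoc]
    have := h.coercive t (u t)
    gcongr
    linarith
  linarith

end EvolutionCoefficients

/-- A solution of the evolution equation in which the maximal monotone operator is replaced by its
Yosida approximation with parameter `l`. -/
structure IsYosidaSolution (G : Set (H × H)) (P Q : ℝ → H →L[ℝ] H) (y₀ v₀ : H) (l : ℝ)
    (y z : ℝ → H) : Prop where
  init : y 0 = y₀
  norm_init_le : ‖z 0‖ ≤ ‖v₀‖
  continuous_y : Continuous y
  continuous_z : Continuous z
  hasDerivAt : ∀ t, 0 ≤ t → HasDerivAt y (velocity P Q t (y t) (z t)) t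
  mem : ∀ t, (y t - l • z t, z t) ∈ G
  mono : ∀ s t, 0 ≤ (inner ℝ (z s - z t) (y s - y t) : ℝ)

variable {P Q K : ℝ → H →L[ℝ] H} {M c : ℝ} {G : Set (H × H)} {y₀ v₀ : H}

theorem EvolutionCoefficients.exists_yosidaSolution [CompleteSpace H]
    (h : EvolutionCoefficients P Q K M c) (hG : IsMaximalMonotone G) (hy₀ : (y₀, v₀) ∈ G) {l : ℝ}
    (hl : 0 < l) : ∃ y z, IsYosidaSolution G P Q y₀ v₀ l y z := by
  obtain ⟨a, ha, halip, hamono, hale⟩ := hG.exists_yosida hl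
  have hM := h.M_nonneg
  have hl' : 0 < l⁻¹ := inv_pos.2 hl
  have hac : Continuous a := by
    refine LipschitzWith.continuous (K := l⁻¹.toNNReal) (LipschitzWith.of_dist_le_mul fun s t => ?_)
    rw [dist_eq_norm, dist_eq_norm, Real.coe_toNNReal _ hl'.le]
    exact halip s t
  -- The velocity with `z = a y` has Lipschitz constant `M (1 + l⁻¹)`; the summand `1` keeps `k`
  -- positive when `M = 0`.
  obtain ⟨y, hy0, hyc, hyd⟩ := exists_forall_hasDerivAt_of_lipschitz
    (f := fun t x => velocity P Q t x (a x)) (k := M * (1 + l⁻¹) + 1) (B := M * ‖a 0‖)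
    (by positivity)
    (by
      have h1 := h.continuous_P
      have h2 := h.continuous_Q
      simp only [velocity, Function.uncurry_def]
      fun_prop)
    (by
      intro t x y
      have h1 : velocity P Q t x (a x) - velocity P Q t y (a y) =
          velocity P Q t (x - y) (a x - a y) := by
        simp only [velocity, map_sub]; abel
      rw [h1]
      refine (h.norm_velocity_le _ _ _).trans ?_
      have := mul_le_mul_of_nonneg_left (halip x y) hM
      nlinarith [norm_nonneg (x - y)])
    (by
      intro t
      simpa using h.norm_velocity_le t 0 (a 0)) y₀
  exact ⟨y, fun t => a (y t), hy0, by rw [hy0]; exact hale _ _ hy₀, hyc, hac.comp hyc, hyd,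
    fun t => ha _, fun s t => hamono _ _⟩

namespace EvolutionCoefficients

variable (h : EvolutionCoefficients P Q K M c)

include h

/-- The solution is compared with the constant `y₀`. Its Yosida value `z 0` is bounded by `‖v₀‖`
because `y₀` lies in the domain, so the forcing term is independent of `l`. -/
theorem exists_yosida_bound (G : Set (H × H)) (y₀ v₀ : H) (S : ℝ) :
    ∃ Y, 0 ≤ Y ∧ ∀ l y z, IsYosidaSolution G P Q y₀ v₀ l y z →
    ∀ t ∈ Icc 0 S, ‖y t‖ ≤ Y := by
  have hM := h.M_nonneg
  have hc := h.c_pos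
  set R := M ^ 2 * (‖y₀‖ + ‖v₀‖)
  set W := Real.exp ((M + (2 * M ^ 2 + 1)) / c * S) * (R ^ 2 * S) / c
  refine ⟨√W + ‖y₀‖, by positivity, fun l y z hy t ht => ?_⟩
  have hgr := h.energy_gronwall (u := fun t => y t - y₀) (C := 2 * M ^ 2 + 1) (B := R ^ 2) ht.1
    (by positivity) (by positivity) (hy.continuous_y.sub continuous_const).continuousOn
    countable_empty (by
      intro s hs _
      refine ⟨_, ((hy.hasDerivAt s hs.1).hasDerivWithinAt.hasWeakRightDeriv).sub_const y₀, ?_⟩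
      have h1 := h.inner_velocity_sub_le s s (x₁ := y s) (z₁ := z s) (x₂ := y₀) (z₂ := z 0) (e := 0)
        (by
          have := hy.mono s 0
          rw [hy.init] at this
          linarith)
      rw [map_sub, inner_sub_left] at h1
      have h2 : (inner ℝ (K s (velocity P Q s y₀ (z 0))) (y s - y₀) : ℝ) ≤ R * ‖y s - y₀‖ := by
        refine (real_inner_le_norm _ _).trans ?_
        gcongr
        calc _ ≤ M * ‖velocity P Q s y₀ (z 0)‖ := (K s).le_of_opNorm_le (h.K_le s) _
          _ ≤ M * (M * (‖y₀‖ + ‖v₀‖)) := by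
            gcongr
            exact (h.norm_velocity_le _ _ _).trans (by gcongr; exact hy.norm_init_le)
          _ = R := by ring
      simp only [sub_self, abs_zero, mul_zero, zero_mul, add_zero, zero_add] at h1
      nlinarith [sq_nonneg (R - ‖y s - y₀‖)])
  have h1 := h.coercive t (y t - y₀)
  simp only [hy.init, sub_self, map_zero, inner_zero_left, zero_add, sub_zero] at hgr
  have hS : 0 ≤ S := ht.1.trans ht.2
  have h2 : c * ‖y t - y₀‖ ^ 2 ≤ Real.exp ((M + (2 * M ^ 2 + 1)) / c * S) * (R ^ 2 * S) := by
    refine h1.trans (hgr.trans ?_)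
    have := ht.1
    have := ht.2
    gcongr
  have h3 : ‖y t - y₀‖ ≤ √W := by
    refine Real.le_sqrt_of_sq_le ?_
    rw [le_div_iff₀ hc]
    linarith
  calc ‖y t‖ ≤ ‖y t - y₀‖ + ‖y₀‖ := norm_le_norm_sub_add _ _
    _ ≤ _ := by gcongr

theorem continuous_velocity {y z : ℝ → H} (hy : Continuous y) (hz : Continuous z) :
    Continuous fun t => velocity P Q t (y t) (z t) := by
  have h1 := h.continuous_P
  have h2 := h.continuous_Q
  simp only [velocity]
  fun_prop

/-- Energy estimate for the increments of a Yosida solution. -/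
theorem yosida_increment_le {Y S : ℝ} {l : ℝ} {y z : ℝ → H}
    (hy : IsYosidaSolution G P Q y₀ v₀ l y z) (hyY : ∀ t ∈ Icc 0 (S + 1), ‖y t‖ ≤ Y) {r t : ℝ}
    (hr : 0 < r) (hr1 : r ≤ 1)
    (hunif : ∀ t ∈ Icc 0 S, ‖velocity P Q (t + r) (y (t + r)) (z (t + r))‖ ≤
      ‖y (t + r) - y t‖ / r + 1) (ht : t ∈ Icc 0 S) :
    c * ‖y (t + r) - y t‖ ^ 2 ≤ Real.exp ((M + (2 * M ^ 2 + 2 * M ^ 3 + 1)) / c * S) *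
      (M * ‖y (0 + r) - y 0‖ ^ 2 + (M ^ 2 * (M * (1 + M * Y) + Y)) ^ 2 * r ^ 2 * S) := by
  have hM := h.M_nonneg
  have hc := h.c_pos
  set D := M ^ 2 * (M * (1 + M * Y) + Y)
  -- In `C`, the term `2 M²` comes from `Q`, `2 M³` from the part of `z (t + r)` controlled by the
  -- increment itself, and `1` from Young's inequality applied to `2 D r w`.
  have hgr := h.energy_gronwall (u := fun t => y (t + r) - y t) (a := 0) (b := t)
    (C := 2 * M ^ 2 + 2 * M ^ 3 + 1) (B := D ^ 2 * r ^ 2) ht.1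
    (by positivity) (by positivity)
    (by
      have := hy.continuous_y
      fun_prop) countable_empty (by
      intro s hs _
      have hsS : s ∈ Icc 0 S := ⟨hs.1, hs.2.le.trans ht.2⟩
      have hsr : s + r ∈ Icc 0 (S + 1) := ⟨by linarith [hs.1], by linarith [hsS.2]⟩
      have d1 : HasWeakRightDeriv y _ (s + r) :=
        (hy.hasDerivAt (s + r) hsr.1).hasDerivWithinAt.hasWeakRightDeriv
      refine ⟨_, d1.comp_add_const.sub
        ((hy.hasDerivAt s hs.1).hasDerivWithinAt.hasWeakRightDeriv), ?_⟩
      have h1 := h.inner_velocity_sub_le (s + r) s (x₁ := y (s + r)) (z₁ := z (s + r)) (x₂ := y s)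
        (z₂ := z s) (e := 0) (by linarith [hy.mono (s + r) s])
      have h2 := h.norm_le_velocity (s + r) (y (s + r)) (z (s + r))
      have h3 := hunif s hsS
      have h4 := hyY _ hsr
      -- Time variation of `P` brings in `‖z‖`, not yet bounded uniformly in `l`. It is controlled
      -- by the velocity, hence through `hunif` by the difference quotient, so Gronwall's inequality
      -- can absorb it.
      have h5 : r * ‖z (s + r)‖ ≤ M * ‖y (s + r) - y s‖ + r * (M * (1 + M * Y)) := by
        calc r * ‖z (s + r)‖ ≤ r * (M * ((‖y (s + r) - y s‖ / r + 1) + M * Y)) := by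
              gcongr
              exact h2.trans (by gcongr)
          _ = _ := by field_simp; ring
      rw [add_sub_cancel_left, abs_of_pos hr] at h1
      set w := ‖y (s + r) - y s‖
      have hw : 0 ≤ w := norm_nonneg _
      have h6 : r * (‖z (s + r)‖ + ‖y (s + r)‖) ≤ M * w + r * (M * (1 + M * Y) + Y) := by
        nlinarith
      have h7 : M ^ 2 * r * (‖z (s + r)‖ + ‖y (s + r)‖) * w ≤ M ^ 3 * w ^ 2 + D * r * w := by
        calc _ = M ^ 2 * w * (r * (‖z (s + r)‖ + ‖y (s + r)‖)) := by ring
          _ ≤ M ^ 2 * w * (M * w + r * (M * (1 + M * Y) + Y)) := by gcongr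
          _ = _ := by ring
      nlinarith [sq_nonneg (D * r - w)])
  have h1 := h.coercive t (y (t + r) - y t)
  refine h1.trans (hgr.trans ?_)
  have h2 := h.energy_le 0 (y (0 + r) - y 0)
  have h3 := ht.1
  have h4 := ht.2
  have h5 : 0 ≤ (inner ℝ (K 0 (y (0 + r) - y 0)) (y (0 + r) - y 0) : ℝ) :=
    (by positivity : 0 ≤ c * ‖y (0 + r) - y 0‖ ^ 2).trans (h.coercive _ _)
  simp only [sub_zero]
  gcongr

/-- The increment estimate divided by `r²` bounds the velocity at `t` by the initial velocity as `r
→ 0`, and the velocity bounds `z`. How small `r` must be depends on the solution, but the resulting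
bound does not. -/
theorem exists_yosida_bound_deriv (G : Set (H × H)) (y₀ v₀ : H) (S : ℝ) :
    ∃ Z, 0 ≤ Z ∧ ∀ l y z, IsYosidaSolution G P Q y₀ v₀ l y z →
    ∀ t ∈ Icc 0 S, ‖z t‖ ≤ Z ∧ ‖y t‖ ≤ Z := by
  have hM := h.M_nonneg
  have hc := h.c_pos
  obtain ⟨Y, hY0, hY⟩ := h.exists_yosida_bound G y₀ v₀ (S + 1)
  set V := M * (‖y₀‖ + ‖v₀‖)
  set W := Real.exp ((M + (2 * M ^ 2 + 2 * M ^ 3 + 1)) / c * S) *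
      (M * V ^ 2 + (M ^ 2 * (M * (1 + M * Y) + Y)) ^ 2 * S) / c
  refine ⟨M * (√W + M * Y) + Y, by positivity, fun l y z hy t ht => ?_⟩
  have hS : 0 ≤ S := ht.1.trans ht.2
  set f := fun t => velocity P Q t (y t) (z t) with hf
  have hfc : Continuous f := h.continuous_velocity hy.continuous_y hy.continuous_z
  have huc := (isCompact_Icc (a := (0 : ℝ)) (b := S + 1)).uniformContinuousOn_of_continuous
    hfc.continuousOn
  obtain ⟨δ, hδ, hδf⟩ := Metric.uniformContinuousOn_iff.1 huc 1 one_pos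
  have hev : ∀ᶠ r : ℝ in 𝓝[>] 0, c * ‖r⁻¹ • (y (t + r) - y t)‖ ^ 2 ≤
      Real.exp ((M + (2 * M ^ 2 + 2 * M ^ 3 + 1)) / c * S) *
      (M * ‖r⁻¹ • (y (0 + r) - y 0)‖ ^ 2 + (M ^ 2 * (M * (1 + M * Y) + Y)) ^ 2 * S) := by
    filter_upwards [Ioo_mem_nhdsGT hδ, Ioo_mem_nhdsGT one_pos] with r hrδ hr1
    have hr0 : 0 < r := hr1.1
    have h1 := h.yosida_increment_le hy (hY l y z hy) hr0 hr1.2.le (by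
      intro s hs
      -- By uniform continuity the velocity varies by less than `1` over `[s, s + r]`, so the
      -- difference quotient differs from the velocity at `s + r` by at most `1`.
      have h2 := Convex.norm_image_sub_le_of_norm_hasDerivWithin_le (𝕜 := ℝ)
        (f := fun q => y q - q • f (s + r)) (f' := fun q => f q - f (s + r)) (C := 1)
        (s := Icc s (s + r)) (x := s) (y := s + r)
        (by
          intro q hq
          have := (hy.hasDerivAt q (hs.1.trans hq.1)).sub
            ((hasDerivAt_id q).smul_const (f (s + r)))
          rw [one_smul] at this
          exact this.hasDerivWithinAt)
        (by
          intro q hq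
          have := hδf q ⟨hs.1.trans hq.1, by linarith [hq.2, hs.2, hr1.2]⟩ (s + r)
            ⟨by linarith [hs.1], by linarith [hs.2, hr1.2]⟩ (by
              rw [Real.dist_eq, abs_sub_lt_iff]
              constructor <;> linarith [hq.1, hq.2, hrδ.2])
          rw [dist_eq_norm] at this
          exact this.le)
        (convex_Icc _ _) (by simp [hr0.le]) (by simp [hr0.le])
      rw [add_sub_cancel_left, one_mul, Real.norm_of_nonneg hr0.le] at h2
      have h3 : y (s + r) - (s + r) • f (s + r) - (y s - s • f (s + r)) =
          y (s + r) - y s - r • f (s + r) := by rw [add_smul]; abel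
      rw [h3] at h2
      have h4 : ‖r • f (s + r)‖ ≤ ‖y (s + r) - y s‖ + r := by
        have := norm_sub_norm_le (r • f (s + r)) (y (s + r) - y s)
        rw [norm_sub_rev (r • f (s + r))] at this
        linarith
      rw [norm_smul, Real.norm_of_nonneg hr0.le] at h4
      have h5 : ‖f (s + r)‖ ≤ (‖y (s + r) - y s‖ + r) / r := by
        rw [le_div_iff₀ hr0]; linarith
      rwa [add_div, div_self hr0.ne'] at h5) ht
    simp only [norm_smul, norm_inv, Real.norm_of_nonneg hr0.le]
    rw [mul_pow r⁻¹, mul_pow r⁻¹]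
    have h6 := mul_le_mul_of_nonneg_left h1 (by positivity : 0 ≤ r⁻¹ ^ 2)
    have h7 : r⁻¹ ^ 2 * r ^ 2 = 1 := by rw [← mul_pow, inv_mul_cancel₀ hr0.ne', one_pow]
    calc _ = r⁻¹ ^ 2 * (c * ‖y (t + r) - y t‖ ^ 2) := by ring
      _ ≤ _ := h6
      _ = Real.exp ((M + (2 * M ^ 2 + 2 * M ^ 3 + 1)) / c * S) *
          (M * (r⁻¹ ^ 2 * ‖y (0 + r) - y 0‖ ^ 2) +
            (M ^ 2 * (M * (1 + M * Y) + Y)) ^ 2 * (r⁻¹ ^ 2 * r ^ 2) * S) := by ring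
      _ = _ := by rw [h7, mul_one]
  have hslope : ∀ t, 0 ≤ t → Tendsto (fun r : ℝ => r⁻¹ • (y (t + r) - y t)) (𝓝[>] 0) (𝓝 (f t)) := by
    intro t ht
    exact (hasDerivAt_iff_tendsto_slope_zero.1 (hy.hasDerivAt t ht)).mono_left
      (nhdsWithin_mono _ fun r hr => (ne_of_gt hr))
  have hle := le_of_tendsto_of_tendsto (((hslope t ht.1).norm.pow 2).const_mul c)
    (((((hslope 0 le_rfl).norm.pow 2).const_mul M).add_const _).const_mul _) hev
  have hf0 : ‖f 0‖ ≤ V := by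
    refine (h.norm_velocity_le _ _ _).trans ?_
    rw [hy.init]
    exact mul_le_mul_of_nonneg_left (by linarith [hy.norm_init_le]) hM
  have hft : ‖f t‖ ≤ √W := by
    refine Real.le_sqrt_of_sq_le ?_
    rw [le_div_iff₀ hc, mul_comm]
    have h8 : ‖f 0‖ ^ 2 ≤ V ^ 2 := pow_le_pow_left₀ (norm_nonneg _) hf0 2
    exact hle.trans (mul_le_mul_of_nonneg_left
      (by linarith [mul_le_mul_of_nonneg_left h8 hM]) (Real.exp_pos _).le)
  have hyt := hY l y z hy t ⟨ht.1, by linarith [ht.2]⟩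
  have hnn : 0 ≤ M * (√W + M * Y) := by positivity
  refine ⟨(h.norm_le_velocity t (y t) (z t)).trans ?_, by linarith⟩
  have : M * (‖f t‖ + M * ‖y t‖) ≤ M * (√W + M * Y) := by gcongr
  exact this.trans (by linarith)

/-- Two Yosida solutions with small parameters are close. -/
theorem yosida_dist_le (hG : IsMonotoneGraph G) {Z S l₁ l₂ : ℝ} (hl₁ : 0 ≤ l₁) (hl₂ : 0 ≤ l₂)
    {y₁ z₁ y₂ z₂ : ℝ → H} (hy₁ : IsYosidaSolution G P Q y₀ v₀ l₁ y₁ z₁)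
    (hy₂ : IsYosidaSolution G P Q y₀ v₀ l₂ y₂ z₂) (hZ : 0 ≤ Z) (hz₁ : ∀ t ∈ Icc 0 S, ‖z₁ t‖ ≤ Z)
    (hz₂ : ∀ t ∈ Icc 0 S, ‖z₂ t‖ ≤ Z) {t : ℝ} (ht : t ∈ Icc 0 S) :
    c * ‖y₁ t - y₂ t‖ ^ 2 ≤
      Real.exp ((M + 2 * M ^ 2) / c * S) * (4 * Z ^ 2 * S) * (l₁ + l₂) := by
  have hM := h.M_nonneg
  have hc := h.c_pos
  have hgr := h.energy_gronwall (u := fun t => y₁ t - y₂ t) (C := 2 * M ^ 2)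
    (B := 4 * Z ^ 2 * (l₁ + l₂)) ht.1 (by positivity) (by positivity)
    (hy₁.continuous_y.sub hy₂.continuous_y).continuousOn countable_empty (by
      intro s hs _
      have hsS : s ∈ Icc 0 S := ⟨hs.1, hs.2.le.trans ht.2⟩
      refine ⟨_, ((hy₁.hasDerivAt s hs.1).hasDerivWithinAt.hasWeakRightDeriv).sub
        ((hy₂.hasDerivAt s hs.1).hasDerivWithinAt.hasWeakRightDeriv), ?_⟩
      have h1 := h.inner_velocity_sub_le s s (x₁ := y₁ s) (z₁ := z₁ s) (x₂ := y₂ s) (z₂ := z₂ s)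
        (e := 2 * Z ^ 2 * (l₁ + l₂)) (by
          have h2 := hG _ (hy₁.mem s) _ (hy₂.mem s)
          have h3 : y₁ s - l₁ • z₁ s - (y₂ s - l₂ • z₂ s) =
            (y₁ s - y₂ s) - (l₁ • z₁ s - l₂ • z₂ s) := by abel
          simp only at h2
          rw [h3, inner_sub_right] at h2
          -- The monotonicity of `G` holds at `yᵢ - lᵢ zᵢ` rather than at `yᵢ`; the discrepancy is
          -- of order `l₁ + l₂` by the uniform bound on `z`.
          have h4 : -(inner ℝ (z₁ s - z₂ s) (l₁ • z₁ s - l₂ • z₂ s) : ℝ) ≤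
              (Z + Z) * (l₁ * Z + l₂ * Z) := by
            refine (neg_le_abs _).trans ((abs_real_inner_le_norm _ _).trans ?_)
            have h5 := hz₁ s hsS
            have h6 := hz₂ s hsS
            gcongr
            · exact (norm_sub_le _ _).trans (by gcongr)
            · refine (norm_sub_le _ _).trans ?_
              rw [norm_smul, norm_smul, Real.norm_of_nonneg hl₁, Real.norm_of_nonneg hl₂]
              gcongr
          linarith)
      simp only [sub_self, abs_zero, mul_zero, zero_mul, add_zero] at h1
      linarith)
  simp only [hy₁.init, hy₂.init, sub_self, map_zero, inner_zero_left, zero_add, sub_zero] at hgr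
  have h1 := h.coercive t (y₁ t - y₂ t)
  refine h1.trans (hgr.trans ?_)
  have h3 := ht.1
  have h4 := ht.2
  calc _ ≤ Real.exp ((M + 2 * M ^ 2) / c * S) * (4 * Z ^ 2 * (l₁ + l₂) * S) := by gcongr
    _ = _ := by ring

end EvolutionCoefficients

end Evolution

/-! ### Passage to the limit and weak differentiability. -/

section WeakSolution

variable {H : Type*} [NormedAddCommGroup H] [InnerProductSpace ℝ H]

/-- Locally Lipschitz functions `y` such that `y' = Q(t) y - P(t) z`, `z ∈ A y`, in the weak
sense. -/
structure IsWeakSolution (G : Set (H × H)) (P Q : ℝ → H →L[ℝ] H) (y z : ℝ → H) : Prop where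
  mem : ∀ t, 0 ≤ t → (y t, z t) ∈ G
  bound : ∀ S, ∃ Z, 0 ≤ Z ∧ ∀ t ∈ Icc 0 S, ‖z t‖ ≤ Z ∧ ‖y t‖ ≤ Z
  lip : ∀ S, ∃ L, 0 ≤ L ∧ ∀ s ∈ Icc 0 S, ∀ t ∈ Icc 0 S, ‖y s - y t‖ ≤ L * |s - t|
  integral : ∀ t, 0 ≤ t → ∀ w, (inner ℝ (y t) w : ℝ) =
    inner ℝ (y 0) w + ∫ r in (0 : ℝ)..t, inner ℝ (velocity P Q r (y r) (z r)) w

variable [CompleteSpace H] {P Q K : ℝ → H →L[ℝ] H} {M c : ℝ} {G : Set (H × H)} {y₀ v₀ : H}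

/-- The Yosida solutions with parameter `1 / (n + 1)` are Cauchy at each time. The points `yₙ - lₙ
zₙ` also converge to `y`, since `zₙ` is bounded, so demiclosedness gives the weak limit of `zₙ`. -/
theorem EvolutionCoefficients.exists_weakSolution (h : EvolutionCoefficients P Q K M c)
    (hG : IsMaximalMonotone G) (hsv : ∀ x u v, (x, u) ∈ G → (x, v) ∈ G → u = v)
    (hy₀ : (y₀, v₀) ∈ G) : ∃ y z, y 0 = y₀ ∧ IsWeakSolution G P Q y z := by
  have hM := h.M_nonneg
  have hc := h.c_pos
  set l : ℕ → ℝ := fun n => 1 / ((n : ℝ) + 1)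
  have hl : ∀ n, 0 < l n := fun n => by positivity
  have hl0 : Tendsto l atTop (𝓝 0) := tendsto_one_div_add_atTop_nhds_zero_nat
  choose yn zn hyn using fun n => h.exists_yosidaSolution hG hy₀ (hl n)
  choose Z hZ0 hZ using h.exists_yosida_bound_deriv G y₀ v₀
  have hzb : ∀ S n t, t ∈ Icc 0 S → ‖zn n t‖ ≤ Z S := fun S n t ht => (hZ S _ _ _ (hyn n) t ht).1
  have hyb : ∀ S n t, t ∈ Icc 0 S → ‖yn n t‖ ≤ Z S := fun S n t ht => (hZ S _ _ _ (hyn n) t ht).2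
  have hcauchy : ∀ t, 0 ≤ t → ∃ x, Tendsto (fun n => yn n t) atTop (𝓝 x) := by
    intro t ht
    refine cauchySeq_tendsto_of_complete ?_
    set A := Real.exp ((M + 2 * M ^ 2) / c * t) * (4 * Z t ^ 2 * t)
    have hA : 0 ≤ A := by positivity
    rw [Metric.cauchySeq_iff']
    intro ε hε
    have hlim : Tendsto (fun n => A * (l n + l n)) atTop (𝓝 (A * (0 + 0))) :=
      (hl0.add hl0).const_mul A
    have hpos : A * (0 + 0) < c * ε ^ 2 := by simp only [add_zero, mul_zero]; positivity
    obtain ⟨n, hn⟩ := (hlim.eventually (gt_mem_nhds hpos)).exists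
    refine ⟨n, fun k hk => ?_⟩
    have hle : l k ≤ l n := Nat.one_div_le_one_div hk
    have h1 := h.yosida_dist_le hG.1 (hl k).le (hl n).le (hyn k) (hyn n) (hZ0 t) (hzb t k)
      (hzb t n) ⟨ht, le_rfl⟩
    rw [dist_eq_norm]
    refine lt_of_pow_lt_pow_left₀ 2 hε.le (lt_of_mul_lt_mul_left ?_ hc.le)
    refine h1.trans_lt (lt_of_le_of_lt ?_ hn)
    gcongr
  choose! y hy using hcauchy
  have hz : ∀ t, 0 ≤ t → ∃ v, (y t, v) ∈ G ∧ ‖v‖ ≤ Z t ∧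
      ∀ w, Tendsto (fun n => (inner ℝ (zn n t) w : ℝ)) atTop (𝓝 (inner ℝ v w)) := by
    intro t ht
    refine hG.demiclosed hsv (x := fun n => yn n t - l n • zn n t)
      (Eventually.of_forall fun n => (hyn n).mem t) ?_
      (Eventually.of_forall fun n => hzb t n t ⟨ht, le_rfl⟩)
    have h1 : Tendsto (fun n => l n • zn n t) atTop (𝓝 0) := by
      have h2 : Tendsto (fun n => l n * Z t) atTop (𝓝 0) := by simpa using hl0.mul_const (Z t)
      refine squeeze_zero_norm (fun n => ?_) h2
      rw [norm_smul, Real.norm_of_nonneg (hl n).le]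
      exact mul_le_mul_of_nonneg_left (hzb t n t ⟨ht, le_rfl⟩) (hl n).le
    simpa using (hy t ht).sub h1
  choose! z hzG hzle hzw using hz
  -- The bound `Z t` from demiclosedness is not known to be locally bounded in `t`; weak lower
  -- semicontinuity of the norm gives a bound uniform on `[0, S]`.
  have hzle' : ∀ S t, t ∈ Icc 0 S → ‖z t‖ ≤ Z S := by
    intro S t ht
    have h1 : (‖z t‖ ^ 2 : ℝ) ≤ Z S * ‖z t‖ := by
      rw [← real_inner_self_eq_norm_sq]
      refine le_of_tendsto (hzw t ht.1 (z t)) (Eventually.of_forall fun n => ?_)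
      exact (real_inner_le_norm _ _).trans (by gcongr; exact hzb S n t ht)
    rcases (norm_nonneg (z t)).eq_or_lt with h0 | h0
    · rw [← h0]; exact hZ0 S
    · nlinarith
  refine ⟨y, z, ?_, hzG, ?_, ?_, ?_⟩
  · exact tendsto_nhds_unique (hy 0 le_rfl) (by simp [(hyn _).init])
  · intro S
    exact ⟨Z S, hZ0 S, fun t ht => ⟨hzle' S t ht, le_of_tendsto (hy t ht.1).norm
      (Eventually.of_forall fun n => hyb S n t ht)⟩⟩
  · intro S
    refine ⟨M * (Z S + Z S), by have := hZ0 S; positivity, fun s hs t ht => ?_⟩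
    refine le_of_tendsto ((hy s hs.1).sub (hy t ht.1)).norm (Eventually.of_forall fun n => ?_)
    rw [← Real.norm_eq_abs]
    refine Convex.norm_image_sub_le_of_norm_hasDerivWithin_le (𝕜 := ℝ) (s := Icc 0 S)
      (fun r hr => ((hyn n).hasDerivAt r hr.1).hasDerivWithinAt) (fun r hr => ?_)
      (convex_Icc _ _) ht hs
    refine (h.norm_velocity_le _ _ _).trans ?_
    have h1 := hyb S n r hr
    have h2 := hzb S n r hr
    gcongr
  · intro t ht w
    have hint : ∀ n, (inner ℝ (yn n t) w : ℝ) = inner ℝ y₀ w +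
        ∫ r in (0 : ℝ)..t, inner ℝ (velocity P Q r (yn n r) (zn n r)) w := by
      intro n
      have hcont : Continuous fun r => (inner ℝ (velocity P Q r (yn n r) (zn n r)) w : ℝ) :=
        (h.continuous_velocity (hyn n).continuous_y (hyn n).continuous_z).inner continuous_const
      rw [intervalIntegral.integral_eq_sub_of_hasDerivAt (f := fun r => (inner ℝ (yn n r) w : ℝ))
        (fun r hr => ?_) (hcont.intervalIntegrable _ _), (hyn n).init]
      · ring
      · rw [uIcc_of_le ht] at hr
        simpa using ((hyn n).hasDerivAt r hr.1).inner ℝ (hasDerivAt_const r w)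
    -- Dominated convergence after testing against `w`; weak convergence of `zₙ` is enough because
    -- `P r` is moved onto `w` by its adjoint.
    have hlim : Tendsto (fun n => ∫ r in (0 : ℝ)..t,
        (inner ℝ (velocity P Q r (yn n r) (zn n r)) w : ℝ)) atTop
        (𝓝 (∫ r in (0 : ℝ)..t, inner ℝ (velocity P Q r (y r) (z r)) w)) := by
      refine intervalIntegral.tendsto_integral_filter_of_dominated_convergence
        (fun _ => M * (Z t + Z t) * ‖w‖) (Eventually.of_forall fun n => ?_)
        (Eventually.of_forall fun n => Eventually.of_forall fun r hr => ?_)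
        intervalIntegrable_const (Eventually.of_forall fun r hr => ?_)
      · exact ((h.continuous_velocity (hyn n).continuous_y (hyn n).continuous_z).inner
          continuous_const).aestronglyMeasurable
      · rw [uIoc_of_le ht] at hr
        refine (norm_inner_le_norm _ _).trans ?_
        have h1 := hyb t n r ⟨hr.1.le, hr.2⟩
        have h2 := hzb t n r ⟨hr.1.le, hr.2⟩
        have h3 := h.norm_velocity_le r (yn n r) (zn n r)
        gcongr
        exact h3.trans (by gcongr)
      · rw [uIoc_of_le ht] at hr
        simp only [velocity, inner_sub_left]
        refine Tendsto.sub ?_ ?_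
        · exact (((Q r).continuous.tendsto _).comp (hy r hr.1.le)).inner tendsto_const_nhds
        · simp only [← ContinuousLinearMap.adjoint_inner_right]
          exact hzw r hr.1.le _
    rw [tendsto_nhds_unique (hy 0 le_rfl) (by simp [(hyn _).init] :
      Tendsto (fun n => yn n 0) atTop (𝓝 y₀))]
    refine tendsto_nhds_unique ((hy t ht).inner tendsto_const_nhds) ?_
    simp only [hint]
    exact hlim.const_add _

namespace IsWeakSolution

variable {y z : ℝ → H} (hw : IsWeakSolution G P Q y z)

include hw

omit [CompleteSpace H] in
theorem continuousOn : ContinuousOn y (Ici 0) := by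
  intro t ht
  obtain ⟨L, hL, hlip⟩ := hw.lip (t + 1)
  have ht0 : (0 : ℝ) ≤ t := ht
  rw [ContinuousWithinAt, tendsto_iff_norm_sub_tendsto_zero]
  have h1 : Tendsto (fun s => L * |s - t|) (𝓝[Ici 0] t) (𝓝 0) := by
    have : Tendsto (fun s => L * |s - t|) (𝓝 t) (𝓝 (L * |t - t|)) :=
      Continuous.tendsto (by fun_prop) t
    simp only [sub_self, abs_zero, mul_zero] at this
    exact this.mono_left nhdsWithin_le_nhds
  refine squeeze_zero' (Eventually.of_forall fun _ => norm_nonneg _) ?_ h1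
  filter_upwards [self_mem_nhdsWithin,
    nhdsWithin_le_nhds (gt_mem_nhds (show t < t + 1 by linarith))] with s hs hs1
  exact hlip s ⟨hs, le_of_lt hs1⟩ t ⟨ht0, by linarith⟩

variable (hG : IsMaximalMonotone G) (hsv : ∀ x u v, (x, u) ∈ G → (x, v) ∈ G → u = v)

include hG hsv

/-- Demiclosedness again, now along `r → t`: `y` converges strongly, `z` is locally bounded, and
single-valuedness identifies the weak limit as `z t`. -/
theorem tendsto_inner_z {t : ℝ} (ht : 0 ≤ t) (w : H) :
    ContinuousWithinAt (fun r => (inner ℝ (z r) w : ℝ)) (Ici 0) t := by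
  obtain ⟨Z, -, hZ⟩ := hw.bound (t + 1)
  have hne : (𝓝[Ici 0] t).NeBot := mem_closure_iff_nhdsWithin_neBot.1 (subset_closure ht)
  obtain ⟨v, hv, -, hvw⟩ := hG.demiclosed hsv (F := 𝓝[Ici 0] t) (x := y) (z := z) (a := y t)
    (C := Z)
    (by filter_upwards [self_mem_nhdsWithin] with s hs using hw.mem s hs)
    (hw.continuousOn t ht)
    (by
      filter_upwards [self_mem_nhdsWithin,
        nhdsWithin_le_nhds (gt_mem_nhds (show t < t + 1 by linarith))] with s hs hs1
      exact (hZ s ⟨hs, le_of_lt hs1⟩).1)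
  rw [hsv _ _ _ hv (hw.mem t ht)] at hvw
  exact hvw w

variable (h : EvolutionCoefficients P Q K M c)

include h

theorem tendsto_inner_velocity {t : ℝ} (ht : 0 ≤ t) (w : H) :
    ContinuousWithinAt (fun r => (inner ℝ (velocity P Q r (y r) (z r)) w : ℝ)) (Ici 0) t := by
  obtain ⟨Z, hZ0, hZ⟩ := hw.bound (t + 1)
  have h1 : ContinuousWithinAt (fun r => (inner ℝ (Q r (y r)) w : ℝ)) (Ici 0) t :=
    (h.continuous_Q.continuousWithinAt.clm_apply (hw.continuousOn t ht)).inner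
      continuousWithinAt_const
  have h2 : Tendsto (fun r => (inner ℝ ((P r - P t) (z r)) w : ℝ)) (𝓝[Ici 0] t) (𝓝 0) := by
    have h3 : Tendsto (fun r => ‖P r - P t‖ * Z * ‖w‖) (𝓝[Ici 0] t) (𝓝 0) := by
      have := h.continuous_P
      have h4 : Tendsto (fun r => ‖P r - P t‖ * Z * ‖w‖) (𝓝 t) (𝓝 (‖P t - P t‖ * Z * ‖w‖)) :=
        Continuous.tendsto (by fun_prop) t
      simp only [sub_self, norm_zero, zero_mul] at h4
      exact h4.mono_left nhdsWithin_le_nhds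
    refine squeeze_zero_norm' ?_ h3
    filter_upwards [self_mem_nhdsWithin,
      nhdsWithin_le_nhds (gt_mem_nhds (show t < t + 1 by linarith))] with s hs hs1
    refine (norm_inner_le_norm _ _).trans ?_
    have h5 := (hZ s ⟨hs, le_of_lt hs1⟩).1
    have h6 := (P s - P t).le_opNorm (z s)
    gcongr
    exact h6.trans (by gcongr)
  have h3 : ContinuousWithinAt (fun r => (inner ℝ (P r (z r)) w : ℝ)) (Ici 0) t := by
    have h4 := h2.add (hw.tendsto_inner_z hG hsv ht (ContinuousLinearMap.adjoint (P t) w))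
    simp only [ContinuousLinearMap.adjoint_inner_right, zero_add, ← inner_add_left, sub_apply,
      sub_add_cancel] at h4
    exact h4
  simp only [velocity, inner_sub_left]
  exact h1.sub h3

theorem hasDerivWithinAt_inner {t : ℝ} (ht : 0 ≤ t) (w : H) :
    HasDerivWithinAt (fun r => (inner ℝ (y r) w : ℝ)) (inner ℝ (velocity P Q t (y t) (z t)) w)
      (Ici 0) t := by
  set φ : ℝ → ℝ := fun r => inner ℝ (velocity P Q r (y r) (z r)) w
  have hφ : ContinuousOn φ (Ici 0) := fun t ht => hw.tendsto_inner_velocity hG hsv h ht w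
  -- Constant extension to negative times makes the integrand continuous on the line, so that the
  -- fundamental theorem of calculus applies at `t = 0` too.
  have hφ' : Continuous fun r => φ (max r 0) :=
    hφ.comp_continuous (by fun_prop) (fun r => le_max_right r 0)
  have h1 := ((hφ'.integral_hasStrictDerivAt 0 t).hasDerivAt.const_add
    (inner ℝ (y 0) w : ℝ)).hasDerivWithinAt (s := Ici 0)
  rw [max_eq_left ht] at h1
  refine h1.congr_of_mem (fun s hs => ?_) ht
  rw [hw.integral s hs w]
  congr 1
  refine intervalIntegral.integral_congr fun r hr => ?_
  rw [uIcc_of_le hs] at hr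
  simp only [max_eq_left hr.1, φ]

theorem hasWeakRightDeriv {t : ℝ} (ht : 0 ≤ t) :
    HasWeakRightDeriv y (velocity P Q t (y t) (z t)) t := by
  refine ⟨?_, fun w => (hw.hasDerivWithinAt_inner hG hsv h ht w).mono fun s hs =>
    ht.trans (le_of_lt hs)⟩
  obtain ⟨L, -, hL⟩ := hw.lip (t + 1)
  refine ⟨L, ?_⟩
  filter_upwards [Ioo_mem_nhdsGT (show t < t + 1 by linarith)] with s hs
  have := hL s ⟨ht.trans hs.1.le, hs.2.le⟩ t ⟨ht, by linarith⟩
  rwa [abs_of_pos (sub_pos.2 hs.1)] at this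

/-- Where `z` is strongly continuous, the mean value inequality for `(y, w)` is uniform over bounded
`w`; taking `w` to be the Taylor remainder itself upgrades the weak derivative to a strong one. -/
theorem hasDerivWithinAt {t : ℝ} (ht : 0 ≤ t) (hz : ContinuousWithinAt z (Ici 0) t) :
    HasDerivWithinAt y (velocity P Q t (y t) (z t)) (Ici 0) t := by
  set f := fun r => velocity P Q r (y r) (z r)
  have hf : ContinuousWithinAt f (Ici 0) t :=
    (h.continuous_Q.continuousWithinAt.clm_apply (hw.continuousOn t ht)).sub
      (h.continuous_P.continuousWithinAt.clm_apply hz)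
  rw [hasDerivWithinAt_iff_isLittleO, Asymptotics.isLittleO_iff]
  intro ε hε
  obtain ⟨δ, hδ, hδf⟩ := Metric.continuousWithinAt_iff.1 hf ε hε
  filter_upwards [self_mem_nhdsWithin, nhdsWithin_le_nhds (Metric.ball_mem_nhds t hδ)] with s hs hsδ
  have key : ∀ w, ‖(inner ℝ (y s - y t - (s - t) • f t) w : ℝ)‖ ≤ ε * ‖w‖ * ‖s - t‖ := by
    intro w
    have h1 := Convex.norm_image_sub_le_of_norm_hasDerivWithin_le (𝕜 := ℝ)
      (f := fun r => (inner ℝ (y r) w : ℝ) - r * inner ℝ (f t) w)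
      (f' := fun r => (inner ℝ (f r) w : ℝ) - 1 * inner ℝ (f t) w) (C := ε * ‖w‖)
      (s := Ici 0 ∩ Metric.ball t δ) (x := t) (y := s)
      (fun r hr => ((hw.hasDerivWithinAt_inner hG hsv h hr.1 w).sub
        ((hasDerivAt_id r).hasDerivWithinAt.mul_const _)).mono inter_subset_left)
      (fun r hr => by
        rw [one_mul, ← inner_sub_left]
        refine (norm_inner_le_norm _ _).trans ?_
        have := hδf hr.1 hr.2
        rw [dist_eq_norm] at this
        gcongr)
      ((convex_Ici 0).inter (convex_ball t δ)) ⟨ht, Metric.mem_ball_self hδ⟩ ⟨hs, hsδ⟩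
    refine le_trans (le_of_eq ?_) h1
    rw [inner_sub_left, inner_sub_left, real_inner_smul_left]
    congr 1
    ring
  have h2 := key (y s - y t - (s - t) • f t)
  rw [real_inner_self_eq_norm_sq, norm_pow, norm_norm] at h2
  rcases (norm_nonneg (y s - y t - (s - t) • f t)).eq_or_lt with h0 | h0
  · rw [← h0]; positivity
  · nlinarith

end IsWeakSolution

end WeakSolution

/-! ### Uniqueness, and strong regularity off a countable set. -/

section Regularity

variable {H : Type*} [NormedAddCommGroup H] [InnerProductSpace ℝ H]
  {P Q K : ℝ → H →L[ℝ] H} {M c : ℝ} {G : Set (H × H)} {y z : ℝ → H}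

theorem EvolutionCoefficients.eq_of_hasDerivWithinAt (h : EvolutionCoefficients P Q K M c)
    (hG : IsMonotoneGraph G) {T : ℝ} (hT : 0 ≤ T) {y₁ z₁ y₂ z₂ : ℝ → H}
    (hc₁ : ContinuousOn y₁ (Icc 0 T)) (hc₂ : ContinuousOn y₂ (Icc 0 T)) (h0 : y₁ 0 = y₂ 0)
    (hm₁ : ∀ t ∈ Icc 0 T, (y₁ t, z₁ t) ∈ G) (hm₂ : ∀ t ∈ Icc 0 T, (y₂ t, z₂ t) ∈ G)
    {N : Set ℝ} (hN : N.Countable)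
    (hd₁ : ∀ t ∈ Ico 0 T, t ∉ N → HasDerivWithinAt y₁ (velocity P Q t (y₁ t) (z₁ t)) (Ici 0) t)
    (hd₂ : ∀ t ∈ Ico 0 T, t ∉ N → HasDerivWithinAt y₂ (velocity P Q t (y₂ t) (z₂ t)) (Ici 0) t) :
    y₁ T = y₂ T := by
  have hM := h.M_nonneg
  have hc := h.c_pos
  have hgr := h.energy_gronwall (u := fun t => y₁ t - y₂ t) (C := 2 * M ^ 2) (B := 0) hT
    (by positivity) le_rfl (hc₁.sub hc₂) hN (by
      intro s hs hsN
      have hsub : Ioi s ⊆ Ici 0 := fun r hr => hs.1.trans (le_of_lt hr)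
      refine ⟨_, ((hd₁ s hs hsN).mono hsub).hasWeakRightDeriv.sub
        ((hd₂ s hs hsN).mono hsub).hasWeakRightDeriv, ?_⟩
      have h1 := h.inner_velocity_sub_le s s (x₁ := y₁ s) (z₁ := z₁ s) (x₂ := y₂ s) (z₂ := z₂ s)
        (e := 0) (by
          have := hG _ (hm₁ s ⟨hs.1, hs.2.le⟩) _ (hm₂ s ⟨hs.1, hs.2.le⟩)
          simp only at this
          linarith)
      simp only [sub_self, abs_zero, mul_zero, zero_mul, add_zero] at h1
      linarith)
  simp only [h0, sub_self, map_zero, inner_zero_left, zero_mul, add_zero, mul_zero] at hgr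
  have h1 := (h.coercive T (y₁ T - y₂ T)).trans hgr
  have h2 : ‖y₁ T - y₂ T‖ ^ 2 ≤ 0 := by
    by_contra! hlt
    exact absurd h1 (not_le.2 (mul_pos hc hlt))
  have h3 : ‖y₁ T - y₂ T‖ = 0 := pow_eq_zero_iff two_ne_zero |>.1 (le_antisymm h2 (sq_nonneg _))
  exact sub_eq_zero.1 (norm_eq_zero.1 h3)

variable [CompleteSpace H]

namespace IsWeakSolution

variable (hw : IsWeakSolution G P Q y z) (hG : IsMaximalMonotone G)
  (hsv : ∀ x u v, (x, u) ∈ G → (x, v) ∈ G → u = v) (h : EvolutionCoefficients P Q K M c)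

include hw hG hsv h

/-- A weak derivative only bounds difference quotients from below in norm; this is the opposite
bound. Monotonicity replaces the velocity at `s + r` by the one at `s` up to `O(r²)` in the
derivative of the increment energy, which is therefore at most `2 r (n2 + ε / 2)`; integration gives
the claim. -/
theorem eventually_increment_energy_le {s : ℝ} (hs : 0 ≤ s) {ε : ℝ} (hε : 0 < ε) :
    ∀ᶠ r in 𝓝[>] (0 : ℝ), (inner ℝ (K s (y (s + r) - y s)) (y (s + r) - y s) : ℝ) ≤
      r ^ 2 * (inner ℝ (K s (velocity P Q s (y s) (z s))) (velocity P Q s (y s) (z s)) + ε) := by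
  have hM := h.M_nonneg
  set f := fun t => velocity P Q t (y t) (z t)
  obtain ⟨L, hL0, hL⟩ := hw.lip (s + 1)
  obtain ⟨Z, hZ0, hZ⟩ := hw.bound (s + 1)
  set n2 : ℝ := inner ℝ (K s (f s)) (f s)
  have hn2 : 0 ≤ n2 := (mul_nonneg h.c_pos.le (sq_nonneg _)).trans (h.coercive s (f s))
  set D := M ^ 2 * L ^ 2 + M ^ 2 * (Z + Z) * L
  have hD : 0 ≤ D := by positivity
  have hweak : ∀ᶠ r in 𝓝[>] (0 : ℝ), (inner ℝ (y (s + r) - y s) (K s (f s)) : ℝ) ≤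
      r * (n2 + ε / 4) := by
    have h1 := eventually_sub_le_of_hasDerivWithinAt
      ((hw.hasWeakRightDeriv hG hsv h hs).2 (K s (f s))) (show 0 < ε / 4 by positivity)
    have h2 := (tendsto_add_const_nhdsGT 0 s).eventually (by rwa [zero_add])
    filter_upwards [h2] with r hr
    rw [inner_sub_left, add_comm s r]
    rw [add_sub_cancel_right, real_inner_comm (K s (f s)) (f s)] at hr
    exact hr
  -- The second bound on `r` makes `D r ≤ ε / 4`. These estimates need `r > 0`, so `0` is declared
  -- exceptional in the Dini argument below.
  obtain ⟨δ, hδ, hδr⟩ := (mem_nhdsGT_iff_exists_Ioo_subset).1 (hweak.and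
    (Ioo_mem_nhdsGT (show (0 : ℝ) < min 1 (ε / (4 * (D + 1))) by positivity)))
  filter_upwards [Ioo_mem_nhdsGT hδ] with r₀ hr₀
  have hcont : ContinuousOn (fun r => y (s + r) - y s) (Icc 0 r₀) :=
    (hw.continuousOn.comp (by fun_prop) (fun r hr => add_nonneg hs hr.1)).sub continuousOn_const
  have key := le_of_upper_dini_nonpos (F := fun r => (inner ℝ (K s (y (s + r) - y s))
    (y (s + r) - y s) : ℝ) - r ^ 2 * (n2 + ε / 2)) hr₀.1.le
    (((continuousOn_const.clm_apply hcont).inner hcont).sub (by fun_prop))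
    (countable_singleton (0 : ℝ)) (by
      intro r hr hr0 η hη
      have hrpos : 0 < r := lt_of_le_of_ne hr.1 (Ne.symm hr0)
      obtain ⟨hr1, hr2⟩ := hδr ⟨hrpos, hr.2.trans hr₀.2⟩
      have hr3 : r ≤ 1 := hr2.2.le.trans (min_le_left _ _)
      have hr4 : D * r ≤ ε / 4 := by
        have h1 := hr2.2.le.trans (min_le_right _ _)
        rw [le_div_iff₀ (by positivity)] at h1
        linarith
      have hsr : s + r ∈ Icc 0 (s + 1) := ⟨by linarith, by linarith⟩
      have d1 : HasWeakRightDeriv (fun q => y (s + q) - y s) (f (s + r)) r := by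
        have := (hw.hasWeakRightDeriv hG hsv h (by linarith : 0 ≤ r + s)).comp_add_const.sub_const
          (y s)
        simpa only [add_comm s, f] using this
      have d2 := d1.energy (K := fun _ => K s) (l := 0) (fun q => by simp) (h.symm s) hη
      have e1 := h.inner_velocity_sub_le (s + r) s (x₁ := y (s + r)) (z₁ := z (s + r)) (x₂ := y s)
        (z₂ := z s) (e := 0) (by
          have := hG.1 _ (hw.mem _ hsr.1) _ (hw.mem s hs)
          simp only at this
          linarith)
      rw [add_sub_cancel_left, abs_of_pos hrpos, map_sub, inner_sub_left] at e1
      have e2 := hL (s + r) hsr s ⟨hs, by linarith⟩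
      rw [add_sub_cancel_left, abs_of_pos hrpos] at e2
      obtain ⟨e3, e4⟩ := hZ (s + r) hsr
      have e5 : M ^ 2 * ‖y (s + r) - y s‖ ^ 2 + M ^ 2 * r * (‖z (s + r)‖ + ‖y (s + r)‖) *
          ‖y (s + r) - y s‖ ≤ D * r * r := by
        calc _ ≤ M ^ 2 * (L * r) ^ 2 + M ^ 2 * r * (Z + Z) * (L * r) := by gcongr
          _ = _ := by ring
      have e6 : (inner ℝ (K s (f s)) (y (s + r) - y s) : ℝ) ≤ r * (n2 + ε / 4) := by
        rw [real_inner_comm]; exact hr1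
      have e7 : 2 * (inner ℝ (K s (f (s + r))) (y (s + r) - y s) : ℝ) ≤
          2 * r * (n2 + ε / 2) := by
        have e8 : D * r * r ≤ ε / 4 * r := by gcongr
        have e9 : (inner ℝ (K s (f (s + r))) (y (s + r) - y s) : ℝ) ≤
          D * r * r + inner ℝ (K s (f s)) (y (s + r) - y s) := by
          simp only [f]; linarith
        linarith
      filter_upwards [d2, self_mem_nhdsWithin] with q hq hqr
      have hqr' : 0 < q - r := sub_pos.2 hqr
      have e8 : (q - r) * (2 * r * (n2 + ε / 2)) ≤ (q ^ 2 - r ^ 2) * (n2 + ε / 2) := by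
        have : 0 ≤ (q - r) ^ 2 * (n2 + ε / 2) := by positivity
        nlinarith
      have e9 := mul_le_mul_of_nonneg_left e7 hqr'.le
      rw [zero_mul, zero_add] at hq
      linarith)
  simp only [add_zero, sub_self, map_zero, inner_zero_left, ne_eq, OfNat.ofNat_ne_zero,
    not_false_eq_true, zero_pow, zero_mul, sub_nonpos] at key
  refine key.trans ?_
  gcongr
  linarith

/-- Gronwall's inequality propagates the energy of increments from `s` to `t`. After division by
`r²`, the side at `s` is bounded by the velocity energy through the previous lemma, and the side at
`t` is bounded below by weak lower semicontinuity. -/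
theorem exists_velocity_energy_le (S : ℝ) : ∃ C B : ℝ, 0 ≤ C ∧ 0 ≤ B ∧ ∀ s t, 0 ≤ s → s ≤ t →
    t ≤ S → (inner ℝ (K t (velocity P Q t (y t) (z t))) (velocity P Q t (y t) (z t)) : ℝ) ≤
      Real.exp (C * (t - s)) *
      (inner ℝ (K s (velocity P Q s (y s) (z s))) (velocity P Q s (y s) (z s)) + B * (t - s)) := by
  have hM := h.M_nonneg
  have hc := h.c_pos
  set f := fun t => velocity P Q t (y t) (z t)
  obtain ⟨Z, hZ0, hZ⟩ := hw.bound (S + 1)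
  set D := M ^ 2 * (Z + Z)
  set C := (M + (2 * M ^ 2 + 1)) / c
  refine ⟨C, D ^ 2, by positivity, by positivity, fun s t hs hst htS => ?_⟩
  have ht := hs.trans hst
  have hexp := Real.exp_pos (C * (t - s))
  refine le_of_forall_pos_le_add fun η hη => ?_
  set ε := η / Real.exp (C * (t - s)) with hεdef
  have hε : 0 < ε := by positivity
  have hεη : Real.exp (C * (t - s)) * ε = η := by rw [hεdef]; field_simp
  have hinc := hw.eventually_increment_energy_le hG hsv h hs hε
  have hgr : ∀ r ∈ Ioo (0 : ℝ) 1, (inner ℝ (K t (y (t + r) - y t)) (y (t + r) - y t) : ℝ) ≤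
      Real.exp (C * (t - s)) *
        (inner ℝ (K s (y (s + r) - y s)) (y (s + r) - y s) + D ^ 2 * r ^ 2 * (t - s)) := by
    intro r hr
    refine h.energy_gronwall (u := fun t => y (t + r) - y t) (C := 2 * M ^ 2 + 1)
      (B := D ^ 2 * r ^ 2) hst (by positivity) (by positivity) ?_ countable_empty ?_
    · refine (hw.continuousOn.comp (by fun_prop) fun q hq => ?_).sub
        (hw.continuousOn.mono fun q hq => hs.trans hq.1)
      exact add_nonneg (hs.trans hq.1) hr.1.le
    · intro q hq _
      have hq0 : 0 ≤ q := hs.trans hq.1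
      have hqr : q + r ∈ Icc 0 (S + 1) :=
        ⟨add_nonneg hq0 hr.1.le, by linarith [hq.2, hr.2]⟩
      refine ⟨_, (hw.hasWeakRightDeriv hG hsv h hqr.1).comp_add_const.sub
        (hw.hasWeakRightDeriv hG hsv h hq0), ?_⟩
      have e1 := h.inner_velocity_sub_le (q + r) q (x₁ := y (q + r)) (z₁ := z (q + r)) (x₂ := y q)
        (z₂ := z q) (e := 0) (by
          have := hG.1 _ (hw.mem _ hqr.1) _ (hw.mem q hq0)
          simp only at this
          linarith)
      rw [add_sub_cancel_left, abs_of_pos hr.1] at e1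
      obtain ⟨e3, e4⟩ := hZ (q + r) hqr
      have hr0 := hr.1
      have e5 : M ^ 2 * r * (‖z (q + r)‖ + ‖y (q + r)‖) * ‖y (q + r) - y q‖ ≤
          D * r * ‖y (q + r) - y q‖ := by
        calc _ ≤ M ^ 2 * r * (Z + Z) * ‖y (q + r) - y q‖ := by gcongr
          _ = _ := by ring
      nlinarith [sq_nonneg (D * r - ‖y (q + r) - y q‖)]
  -- With `q` the difference quotient and `f` the velocity, this is `2 (q, f) - (f, f) ≤ (q, q)` in
  -- the inner product of `K t`; its left side converges under weak convergence of `q`.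
  have hlow : ∀ r : ℝ, 0 < r → 2 * (r⁻¹ * (inner ℝ (y (t + r)) (K t (f t)) -
      inner ℝ (y t) (K t (f t)))) - inner ℝ (K t (f t)) (f t) ≤
      (r ^ 2)⁻¹ * inner ℝ (K t (y (t + r) - y t)) (y (t + r) - y t) := by
    intro r hr
    have e1 := (mul_nonneg hc.le (sq_nonneg _)).trans (h.coercive t (r⁻¹ • (y (t + r) - y t) - f t))
    have e2 : (inner ℝ (K t (r⁻¹ • (y (t + r) - y t) - f t)) (r⁻¹ • (y (t + r) - y t) - f t) : ℝ) =
        (r ^ 2)⁻¹ * inner ℝ (K t (y (t + r) - y t)) (y (t + r) - y t) -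
        2 * (r⁻¹ * (inner ℝ (y (t + r)) (K t (f t)) - inner ℝ (y t) (K t (f t)))) +
        inner ℝ (K t (f t)) (f t) := by
      rw [← inner_sub_left]
      simp only [map_sub _ (r⁻¹ • _), map_smul, inner_sub_left _ _ (r⁻¹ • _ - _)]
      rw [inner_sub_right, inner_sub_right, real_inner_smul_left, real_inner_smul_left,
        real_inner_smul_right, real_inner_smul_right, h.symm t (y (t + r) - y t) (f t),
        real_inner_comm (y (t + r) - y t) (K t (f t))]
      ring
    linarith
  have hlim : Tendsto (fun r : ℝ => 2 * (r⁻¹ * ((inner ℝ (y (t + r)) (K t (f t)) : ℝ) -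
      inner ℝ (y t) (K t (f t)))) - inner ℝ (K t (f t)) (f t)) (𝓝[>] 0)
      (𝓝 (2 * inner ℝ (f t) (K t (f t)) - inner ℝ (K t (f t)) (f t))) := by
    have e1 := (hasDerivWithinAt_iff_tendsto_slope' (by simp)).1
      ((hw.hasWeakRightDeriv hG hsv h ht).2 (K t (f t)))
    have e2 : Tendsto (fun r : ℝ => r⁻¹ * ((inner ℝ (y (t + r)) (K t (f t)) : ℝ) -
        inner ℝ (y t) (K t (f t)))) (𝓝[>] 0) (𝓝 (inner ℝ (f t) (K t (f t)))) := by
      have e3 := tendsto_add_const_nhdsGT 0 t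
      rw [zero_add] at e3
      refine (e1.comp e3).congr fun r => ?_
      simp only [Function.comp_apply, slope_def_field, add_comm r t]
      rw [div_eq_inv_mul, add_sub_cancel_left]
    exact (e2.const_mul 2).sub_const _
  have hfin : 2 * inner ℝ (f t) (K t (f t)) - inner ℝ (K t (f t)) (f t) ≤
      Real.exp (C * (t - s)) * (inner ℝ (K s (f s)) (f s) + ε + D ^ 2 * (t - s)) := by
    refine le_of_tendsto hlim ?_
    filter_upwards [hinc, Ioo_mem_nhdsGT one_pos] with r hr1 hr2
    have hr0 := hr2.1
    refine (hlow r hr0).trans ?_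
    rw [inv_mul_le_iff₀ (by positivity)]
    refine (hgr r hr2).trans ?_
    calc _ ≤ Real.exp (C * (t - s)) * (r ^ 2 * (inner ℝ (K s (f s)) (f s) + ε) +
          D ^ 2 * r ^ 2 * (t - s)) := by gcongr
      _ = _ := by ring
  have hcomm : (inner ℝ (f t) (K t (f t)) : ℝ) = inner ℝ (K t (f t)) (f t) := real_inner_comm _ _
  rw [← hεη]
  change (inner ℝ (K t (f t)) (f t) : ℝ) ≤ Real.exp (C * (t - s)) *
    (inner ℝ (K s (f s)) (f s) + D ^ 2 * (t - s)) + Real.exp (C * (t - s)) * ε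
  linarith

theorem countable_not_continuousWithinAt_energy : {t | 0 ≤ t ∧ ¬ ContinuousWithinAt (fun t =>
    (inner ℝ (K t (velocity P Q t (y t) (z t))) (velocity P Q t (y t) (z t)) : ℝ))
      (Ici 0) t}.Countable := by
  set n2 : ℝ → ℝ := fun t =>
    inner ℝ (K t (velocity P Q t (y t) (z t))) (velocity P Q t (y t) (z t))
  choose C B hC hB hCB using hw.exists_velocity_energy_le hG hsv h
  -- The Gronwall bound says that this normalised energy is antitone on `[0, S]`, hence has
  -- countably many discontinuities.
  set ψ : ℝ → ℝ → ℝ := fun S t => Real.exp (-(C S * t)) * n2 t - B S * t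
  have hanti : ∀ S, AntitoneOn (ψ S) (Icc 0 S) := by
    intro S s hs t ht hst
    have h1 := hCB S s t hs.1 hst ht.2
    have h2 : Real.exp (-(C S * t)) * Real.exp (C S * (t - s)) = Real.exp (-(C S * s)) := by
      rw [← Real.exp_add]; congr 1; ring
    have h3 := mul_le_mul_of_nonneg_left h1 (Real.exp_pos (-(C S * t))).le
    rw [← mul_assoc, h2] at h3
    have h4 : Real.exp (-(C S * s)) ≤ 1 :=
      Real.exp_le_one_iff.2 (neg_nonpos.2 (mul_nonneg (hC S) hs.1))
    have h5 : Real.exp (-(C S * s)) * (B S * (t - s)) ≤ B S * (t - s) :=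
      mul_le_of_le_one_left (mul_nonneg (hB S) (sub_nonneg.2 hst)) h4
    simp only [ψ, n2]
    linarith
  refine Countable.mono ?_ (countable_iUnion fun n : ℕ =>
    (hanti n).countable_not_continuousWithinAt)
  rintro t ⟨ht, hnc⟩
  obtain ⟨n, hn⟩ := exists_nat_gt t
  refine mem_iUnion.2 ⟨n, ⟨ht, hn.le⟩, fun hcont => hnc ?_⟩
  have h1 : ContinuousWithinAt (ψ n) (Ici 0) t := by
    refine hcont.mono_of_mem_nhdsWithin ?_
    exact inter_mem self_mem_nhdsWithin (nhdsWithin_le_nhds (Iic_mem_nhds hn))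
  have h2 : ContinuousWithinAt (fun r => Real.exp (C n * r) * (ψ n r + B n * r)) (Ici 0) t := by
    have h3 : ContinuousWithinAt (fun r : ℝ => Real.exp (C n * r)) (Ici 0) t := by fun_prop
    have h4 : ContinuousWithinAt (fun r : ℝ => B n * r) (Ici 0) t := by fun_prop
    exact h3.mul (h1.add h4)
  have h3 : (fun r => Real.exp (C n * r) * (ψ n r + B n * r)) = n2 := by
    funext r
    simp only [ψ, sub_add_cancel]
    rw [← mul_assoc, ← Real.exp_add, add_neg_cancel, Real.exp_zero, one_mul]
  rwa [h3] at h2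

/-- The Radon–Riesz argument in the moving norm `(K r ·, ·)`: weak convergence of the velocity and
convergence of its energy give strong convergence, and `z = K (Q y - velocity)` inherits it. -/
theorem continuousWithinAt_of_energy {t : ℝ} (ht : 0 ≤ t)
    (hn : ContinuousWithinAt (fun t => (inner ℝ (K t (velocity P Q t (y t) (z t)))
      (velocity P Q t (y t) (z t)) : ℝ)) (Ici 0) t) : ContinuousWithinAt z (Ici 0) t := by
  have hM := h.M_nonneg
  have hc := h.c_pos
  set f := fun t => velocity P Q t (y t) (z t)
  obtain ⟨Z, hZ0, hZ⟩ := hw.bound (t + 1)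
  have hfZ : ∀ᶠ r in 𝓝[Ici 0] t, ‖f r‖ ≤ M * (Z + Z) := by
    filter_upwards [self_mem_nhdsWithin,
      nhdsWithin_le_nhds (gt_mem_nhds (show t < t + 1 by linarith))] with s hs hs1
    obtain ⟨h1, h2⟩ := hZ s ⟨hs, le_of_lt hs1⟩
    exact (h.norm_velocity_le _ _ _).trans (by gcongr)
  have hKt : Tendsto (fun r => K r (f t)) (𝓝[Ici 0] t) (𝓝 (K t (f t))) :=
    (h.continuous_K.continuousWithinAt.clm_apply continuousWithinAt_const)
  have hcross : Tendsto (fun r => (inner ℝ (f r) (K r (f t)) : ℝ)) (𝓝[Ici 0] t)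
      (𝓝 (inner ℝ (f t) (K t (f t)))) := by
    have h1 : Tendsto (fun r => (inner ℝ (f r) (K r (f t) - K t (f t)) : ℝ)) (𝓝[Ici 0] t) (𝓝 0) := by
      have h2 : Tendsto (fun r => M * (Z + Z) * ‖K r (f t) - K t (f t)‖) (𝓝[Ici 0] t) (𝓝 0) := by
        simpa using (tendsto_iff_norm_sub_tendsto_zero.1 hKt).const_mul (M * (Z + Z))
      refine squeeze_zero_norm' ?_ h2
      filter_upwards [hfZ] with r hr
      exact (norm_inner_le_norm _ _).trans (by gcongr)
    have h3 := h1.add (hw.tendsto_inner_velocity hG hsv h ht (K t (f t)))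
    rw [zero_add] at h3
    refine h3.congr fun r => ?_
    rw [inner_sub_right, sub_add_cancel]
  have hen : Tendsto (fun r => (inner ℝ (K r (f r - f t)) (f r - f t) : ℝ)) (𝓝[Ici 0] t) (𝓝 0) := by
    have h1 : Tendsto (fun r => (inner ℝ (K r (f r)) (f r) : ℝ) - 2 * inner ℝ (f r) (K r (f t)) +
        inner ℝ (K r (f t)) (f t)) (𝓝[Ici 0] t) (𝓝 (inner ℝ (K t (f t)) (f t) -
        2 * inner ℝ (f t) (K t (f t)) + inner ℝ (K t (f t)) (f t))) :=
      (hn.tendsto.sub (hcross.const_mul 2)).add (hKt.inner tendsto_const_nhds)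
    have h2 : (inner ℝ (K t (f t)) (f t) : ℝ) - 2 * inner ℝ (f t) (K t (f t)) +
        inner ℝ (K t (f t)) (f t) = 0 := by
      rw [real_inner_comm (K t (f t)) (f t)]; ring
    rw [h2] at h1
    refine h1.congr fun r => ?_
    rw [map_sub, inner_sub_left, inner_sub_right, inner_sub_right, h.symm r (f r) (f t),
      real_inner_comm (f r) (K r (f t))]
    ring
  have hf : ContinuousWithinAt f (Ici 0) t := by
    rw [ContinuousWithinAt, tendsto_iff_norm_sub_tendsto_zero]
    have h1 : Tendsto (fun r => ‖f r - f t‖ ^ 2) (𝓝[Ici 0] t) (𝓝 0) := by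
      have h2 := hen.div_const c
      rw [zero_div] at h2
      refine squeeze_zero (fun _ => sq_nonneg _) (fun r => ?_) h2
      rw [le_div_iff₀ hc, mul_comm]
      exact h.coercive r _
    have h3 := h1.sqrt
    simpa using h3
  have hz : ContinuousWithinAt (fun r => K r (Q r (y r) - f r)) (Ici 0) t :=
    h.continuous_K.continuousWithinAt.clm_apply
      ((h.continuous_Q.continuousWithinAt.clm_apply (hw.continuousOn t ht)).sub hf)
  have heq : (fun r => K r (Q r (y r) - f r)) = z := by
    funext r
    simp only [f, velocity, sub_sub_cancel, h.left_inv]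
  rwa [heq] at hz

/-- Outside a countable set, `z` is strongly continuous and `y` is differentiable. -/
theorem exists_countable : ∃ N : Set ℝ, N.Countable ∧ ∀ t, 0 ≤ t → t ∉ N →
    HasDerivWithinAt y (velocity P Q t (y t) (z t)) (Ici 0) t ∧ ContinuousWithinAt z (Ici 0) t := by
  refine ⟨_, hw.countable_not_continuousWithinAt_energy hG hsv h, fun t ht htN => ?_⟩
  have hn := not_not.1 fun hnc => htN ⟨ht, hnc⟩
  have hz := hw.continuousWithinAt_of_energy hG hsv h ht hn
  exact ⟨hw.hasDerivWithinAt hG hsv h ht hz, hz⟩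

end IsWeakSolution

end Regularity

/-! ### Bounded Lipschitz operator families and their inverses. -/

section BddLipschitz

variable {H : Type*} [NormedAddCommGroup H] [NormedSpace ℝ H]

/-- Boundedness and Lipschitz continuity in time of an operator family on `[0, T]`. -/
def BddLipschitzOn (T : ℝ) (f : ℝ → H →L[ℝ] H) : Prop :=
  ∃ M, 0 ≤ M ∧ (∀ t ∈ Icc 0 T, ‖f t‖ ≤ M) ∧
    ∀ s ∈ Icc 0 T, ∀ t ∈ Icc 0 T, ‖f s - f t‖ ≤ M * |s - t|

namespace BddLipschitzOn

variable {T : ℝ} {f g : ℝ → H →L[ℝ] H}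

theorem add (hf : BddLipschitzOn T f) (hg : BddLipschitzOn T g) :
    BddLipschitzOn T fun t => f t + g t := by
  obtain ⟨M, hM, hf, hf'⟩ := hf
  obtain ⟨L, hL, hg, hg'⟩ := hg
  refine ⟨M + L, by positivity, fun t ht => (norm_add_le _ _).trans (add_le_add (hf t ht) (hg t ht)),
    fun s hs t ht => ?_⟩
  rw [add_sub_add_comm, add_mul]
  exact (norm_add_le _ _).trans (add_le_add (hf' s hs t ht) (hg' s hs t ht))

theorem mul (hf : BddLipschitzOn T f) (hg : BddLipschitzOn T g) :
    BddLipschitzOn T fun t => f t * g t := by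
  obtain ⟨M, hM, hf, hf'⟩ := hf
  obtain ⟨L, hL, hg, hg'⟩ := hg
  refine ⟨M * L + M * L, by positivity, fun t ht => ?_, fun s hs t ht => ?_⟩
  · have h1 := hf t ht
    have h2 := hg t ht
    calc ‖f t * g t‖ ≤ ‖f t‖ * ‖g t‖ := norm_mul_le _ _
      _ ≤ M * L := by gcongr
      _ ≤ M * L + M * L := le_add_of_nonneg_left (by positivity)
  · have h1 := hf s hs
    have h2 := hg t ht
    have h3 := hf' s hs t ht
    have h4 := hg' s hs t ht
    have h5 : f s * g s - f t * g t = f s * (g s - g t) + (f s - f t) * g t := by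
      rw [mul_sub, sub_mul]; abel
    rw [h5]
    calc _ ≤ ‖f s‖ * ‖g s - g t‖ + ‖f s - f t‖ * ‖g t‖ :=
          (norm_add_le _ _).trans (add_le_add (norm_mul_le _ _) (norm_mul_le _ _))
      _ ≤ M * (L * |s - t|) + M * |s - t| * L := by gcongr
      _ = _ := by ring

theorem const_smul (hf : BddLipschitzOn T f) (a : ℝ) : BddLipschitzOn T fun t => a • f t := by
  obtain ⟨M, hM, hf, hf'⟩ := hf
  refine ⟨|a| * M, by positivity, fun t ht => ?_, fun s hs t ht => ?_⟩
  · rw [norm_smul, Real.norm_eq_abs]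
    exact mul_le_mul_of_nonneg_left (hf t ht) (abs_nonneg a)
  · rw [← smul_sub, norm_smul, Real.norm_eq_abs, mul_assoc]
    exact mul_le_mul_of_nonneg_left (hf' s hs t ht) (abs_nonneg a)

theorem of_lipschitz {ν : ℝ} (hν : 0 ≤ ν)
    (h : ∀ s ∈ Icc 0 T, ∀ t ∈ Icc 0 T, ‖f t - f s‖ ≤ ν * |t - s|) : BddLipschitzOn T f := by
  refine ⟨max (‖f 0‖ + ν * T) ν, hν.trans (le_max_right _ _), fun t ht => ?_, fun s hs t ht => ?_⟩
  · have h0 : (0 : ℝ) ∈ Icc 0 T := ⟨le_rfl, ht.1.trans ht.2⟩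
    have h1 := h 0 h0 t ht
    rw [sub_zero, abs_of_nonneg ht.1] at h1
    have h2 : ν * t ≤ ν * T := mul_le_mul_of_nonneg_left ht.2 hν
    refine le_trans ?_ (le_max_left _ _)
    linarith [norm_le_norm_sub_add (f t) (f 0)]
  · exact (h t ht s hs).trans (by gcongr; exact le_max_right _ _)

theorem continuousOn (hf : BddLipschitzOn T f) : ContinuousOn f (Icc 0 T) := by
  obtain ⟨M, hM, -, hf⟩ := hf
  refine (LipschitzOnWith.of_dist_le_mul (K := ⟨M, hM⟩) fun s hs t ht => ?_).continuousOn
  rw [dist_eq_norm, dist_eq_norm, Real.norm_eq_abs]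
  exact hf s hs t ht

/-- Continuity of inversion bounds the inverses on the compact interval; the identity `a⁻¹ - b⁻¹ =
a⁻¹ (b - a) b⁻¹` then gives the Lipschitz estimate. -/
theorem inverse [CompleteSpace H] (hf : BddLipschitzOn T f)
    (hinv : ∀ t ∈ Icc 0 T, (f t).IsInvertible) : BddLipschitzOn T fun t => (f t).inverse := by
  have hc : ContinuousOn (fun t => (f t).inverse) (Icc 0 T) := fun t ht =>
    ((hinv t ht).contDiffAt_map_inverse (n := 0)).continuousAt.comp_continuousWithinAt
      (hf.continuousOn t ht)
  obtain ⟨R, hR⟩ := isCompact_Icc.exists_bound_of_continuousOn hc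
  obtain ⟨M, hM, -, hf⟩ := hf
  set R' := max R 0
  have hR' : ∀ t ∈ Icc 0 T, ‖(f t).inverse‖ ≤ R' := fun t ht => (hR t ht).trans (le_max_left _ _)
  have hR0 : 0 ≤ R' := le_max_right _ _
  refine ⟨R' + R' * M * R', by positivity, fun t ht => ?_, fun s hs t ht => ?_⟩
  · exact (hR' t ht).trans (le_add_of_nonneg_right (by positivity))
  · have h1 : (f s).inverse - (f t).inverse = (f s).inverse * (f t - f s) * (f t).inverse := by
      ext x
      simp only [sub_apply, ContinuousLinearMap.mul_def, ContinuousLinearMap.comp_apply, map_sub,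
        (hinv s hs).inverse_apply_self, (hinv t ht).self_apply_inverse]
    have h2 := hR' s hs
    have h3 := hR' t ht
    have h4 := hf t ht s hs
    rw [h1]
    calc _ ≤ ‖(f s).inverse‖ * ‖f t - f s‖ * ‖(f t).inverse‖ :=
          (norm_mul_le _ _).trans (by gcongr; exact norm_mul_le _ _)
      _ ≤ R' * (M * |t - s|) * R' := by gcongr
      _ = R' * M * R' * |s - t| := by rw [abs_sub_comm]; ring
      _ ≤ _ := by gcongr; exact le_add_of_nonneg_left hR0

theorem of_contDiffOn (hf : ContDiffOn ℝ 1 f (Ici 0)) (T : ℝ) : BddLipschitzOn T f := by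
  have hc := (hf.continuousOn_derivWithin (uniqueDiffOn_Ici 0) le_rfl).mono
    (Icc_subset_Ici_self : Icc 0 T ⊆ Ici 0)
  obtain ⟨R, hR⟩ := isCompact_Icc.exists_bound_of_continuousOn hc
  refine of_lipschitz (ν := max R 0) (le_max_right _ _) fun s hs t ht => ?_
  rw [← Real.norm_eq_abs]
  refine (convex_Icc 0 T).norm_image_sub_le_of_norm_hasDerivWithin_le (𝕜 := ℝ) (fun r hr => ?_)
    (fun r hr => (hR r hr).trans (le_max_left R 0)) hs ht
  exact ((hf.differentiableOn one_ne_zero) r hr.1).hasDerivWithinAt.mono Icc_subset_Ici_self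

end BddLipschitzOn

theorem HasDerivWithinAt.clm_inverse [CompleteSpace H] {f : ℝ → H →L[ℝ] H} {f' : H →L[ℝ] H}
    {s : Set ℝ} {t : ℝ} (hf : HasDerivWithinAt f f' s t) (ht : t ∈ s)
    (hinv : ∀ r ∈ s, (f r).IsInvertible) :
    HasDerivWithinAt (fun r => (f r).inverse) (-((f t).inverse * f' * (f t).inverse)) s t := by
  have hc : ContinuousWithinAt (fun r => (f r).inverse) s t :=
    ((hinv t ht).contDiffAt_map_inverse (n := 0)).continuousAt.comp_continuousWithinAt
      hf.continuousWithinAt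
  rw [hasDerivWithinAt_iff_tendsto_slope] at hf ⊢
  have h1 := (((hc.mono sdiff_subset).tendsto.mul hf).mul_const (f t).inverse).neg
  refine h1.congr' ?_
  filter_upwards [self_mem_nhdsWithin] with r hr
  ext x
  simp only [slope_def_module, neg_apply, smul_apply, sub_apply, ContinuousLinearMap.mul_def, ContinuousLinearMap.comp_apply,
    map_smul, map_sub, (hinv r hr.1).inverse_apply_self, (hinv t ht).self_apply_inverse]
  rw [← smul_neg, neg_sub]

end BddLipschitz

/-! ### Freezing the coefficients outside `[0, T]`. -/

section Main

variable {H : Type*} [NormedAddCommGroup H] [InnerProductSpace ℝ H]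

theorem abs_max_min_sub_le (T s t : ℝ) : |max 0 (min s T) - max 0 (min t T)| ≤ |s - t| := by
  rw [max_comm 0, max_comm 0]
  refine (abs_max_sub_max_le_abs _ _ _).trans ((abs_min_sub_min_le_max s T t T).trans ?_)
  simp

/-- Projection of time onto `[0, T]` is 1-Lipschitz, so bounds valid on `[0, T]` become the global
ones that `EvolutionCoefficients` demands, without changing the equation on `[0, T]`. -/
theorem exists_evolutionCoefficients_clamp {T c : ℝ} (hT : 0 ≤ T) (hc : 0 < c)
    {P Q K : ℝ → H →L[ℝ] H} (hP : BddLipschitzOn T P) (hQ : BddLipschitzOn T Q)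
    (hK : BddLipschitzOn T K)
    (hsymm : ∀ t ∈ Icc 0 T, ∀ x y, (inner ℝ (K t x) y : ℝ) = inner ℝ x (K t y))
    (hcoer : ∀ t ∈ Icc 0 T, ∀ x, c * ‖x‖ ^ 2 ≤ inner ℝ (K t x) x)
    (hinv : ∀ t ∈ Icc 0 T, ∀ x, K t (P t x) = x) :
    ∃ M, EvolutionCoefficients (fun t => P (max 0 (min t T))) (fun t => Q (max 0 (min t T)))
      (fun t => K (max 0 (min t T))) M c := by
  obtain ⟨M₁, h₁, hP, hP'⟩ := hP
  obtain ⟨M₂, h₂, hQ, hQ'⟩ := hQ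
  obtain ⟨M₃, h₃, hK, hK'⟩ := hK
  have hmem : ∀ t, max 0 (min t T) ∈ Icc 0 T := fun t =>
    ⟨le_max_left _ _, max_le hT (min_le_right _ _)⟩
  have hM₁ : M₁ ≤ M₁ + M₂ + M₃ := by linarith
  have hM₂ : M₂ ≤ M₁ + M₂ + M₃ := by linarith
  have hM₃ : M₃ ≤ M₁ + M₂ + M₃ := by linarith
  have hM : 0 ≤ M₁ + M₂ + M₃ := by positivity
  exact ⟨M₁ + M₂ + M₃,
    { M_nonneg := hM
      c_pos := hc
      P_le := fun t => (hP _ (hmem t)).trans hM₁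
      Q_le := fun t => (hQ _ (hmem t)).trans hM₂
      K_le := fun t => (hK _ (hmem t)).trans hM₃
      P_lip := fun s t => (hP' _ (hmem s) _ (hmem t)).trans
        (mul_le_mul hM₁ (abs_max_min_sub_le T s t) (abs_nonneg _) hM)
      Q_lip := fun s t => (hQ' _ (hmem s) _ (hmem t)).trans
        (mul_le_mul hM₂ (abs_max_min_sub_le T s t) (abs_nonneg _) hM)
      K_lip := fun s t => (hK' _ (hmem s) _ (hmem t)).trans
        (mul_le_mul hM₃ (abs_max_min_sub_le T s t) (abs_nonneg _) hM)
      symm := fun t => hsymm _ (hmem t)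
      coercive := fun t => hcoer _ (hmem t)
      left_inv := fun t => hinv _ (hmem t) }⟩

end Main

/-! ### Gluing in time and the change of unknown `y = D x`. -/

section Conjugation

variable {H : Type*} [NormedAddCommGroup H] [InnerProductSpace ℝ H] [CompleteSpace H]

/-- Gluing of the solutions of the evolution equations with coefficients frozen after time `T`. -/
theorem exists_strongSolution {G : Set (H × H)} (hG : IsMaximalMonotone G)
    (hsv : ∀ x u v, (x, u) ∈ G → (x, v) ∈ G → u = v) {P Q K : ℝ → H →L[ℝ] H}
    (hcoef : ∀ T, 0 < T → ∃ M c, EvolutionCoefficients (fun t => P (max 0 (min t T)))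
      (fun t => Q (max 0 (min t T))) (fun t => K (max 0 (min t T))) M c)
    {y₀ v₀ : H} (hy₀ : (y₀, v₀) ∈ G) :
    ∃ y z : ℝ → H, y 0 = y₀ ∧ ContinuousOn y (Ici 0) ∧ (∀ t, 0 ≤ t → (y t, z t) ∈ G) ∧
      ∃ N : Set ℝ, N.Countable ∧ ∀ t, 0 ≤ t → t ∉ N →
        HasDerivWithinAt y (velocity P Q t (y t) (z t)) (Ici 0) t ∧
          ContinuousWithinAt z (Ici 0) t := by
  choose M c h using fun n : ℕ => hcoef ((n : ℝ) + 1) (by positivity)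
  have hvel : ∀ (n : ℕ) (s : ℝ), 0 ≤ s → s ≤ n + 1 → ∀ y z,
      velocity (fun t => P (max 0 (min t ((n : ℝ) + 1)))) (fun t => Q (max 0 (min t ((n : ℝ) + 1)))) s
        y z = velocity P Q s y z := by
    intro n s hs hsn y z
    simp only [velocity, min_eq_left hsn, max_eq_right hs]
  choose yn zn hinit hw using fun n => (h n).exists_weakSolution hG hsv hy₀
  choose N hN hNd using fun n => (hw n).exists_countable hG hsv (h n)
  have hagree : ∀ (m n : ℕ) (t : ℝ), 0 ≤ t → t ≤ m + 1 → t ≤ n + 1 → yn m t = yn n t := by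
    intro m n t ht hm hn
    refine (h m).eq_of_hasDerivWithinAt hG.1 ht (z₁ := zn m) (z₂ := zn n)
      ((hw m).continuousOn.mono Icc_subset_Ici_self) ((hw n).continuousOn.mono Icc_subset_Ici_self)
      ((hinit m).trans (hinit n).symm) (fun s hs => (hw m).mem s hs.1) (fun s hs => (hw n).mem s hs.1)
      ((hN m).union (hN n)) (fun s hs hsN => ?_) (fun s hs hsN => ?_)
    · exact (hNd m s hs.1 fun hc => hsN (Or.inl hc)).1
    · rw [hvel m s hs.1 (hs.2.le.trans hm), ← hvel n s hs.1 (hs.2.le.trans hn)]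
      exact (hNd n s hs.1 fun hc => hsN (Or.inr hc)).1
  have hagree' : ∀ (m n : ℕ) (t : ℝ), 0 ≤ t → t ≤ m + 1 → t ≤ n + 1 → zn m t = zn n t := by
    intro m n t ht hm hn
    refine hsv _ _ _ ((hw m).mem t ht) ?_
    rw [hagree m n t ht hm hn]
    exact (hw n).mem t ht
  -- Horizon `n + 1` rather than `n`: the solution of index `⌊t⌋₊` is then valid beyond `t`, so near
  -- `t` the glued function is a single solution.
  have hfloor : ∀ t : ℝ, t < ⌊t⌋₊ + 1 := Nat.lt_floor_add_one
  have hev : ∀ t : ℝ, 0 ≤ t → ∀ᶠ s in 𝓝[Ici 0] t,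
      yn ⌊s⌋₊ s = yn ⌊t⌋₊ s ∧ zn ⌊s⌋₊ s = zn ⌊t⌋₊ s := by
    intro t ht
    filter_upwards [self_mem_nhdsWithin, nhdsWithin_le_nhds (gt_mem_nhds (hfloor t))] with s hs hst
    exact ⟨hagree _ _ s hs (hfloor s).le (le_of_lt hst), hagree' _ _ s hs (hfloor s).le (le_of_lt hst)⟩
  refine ⟨fun t => yn ⌊t⌋₊ t, fun t => zn ⌊t⌋₊ t, hinit _, fun t ht => ?_,
    fun t ht => (hw _).mem t ht, ⋃ n, N n, countable_iUnion hN, fun t ht htN => ?_⟩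
  · exact ((hw _).continuousOn t ht).congr_of_eventuallyEq ((hev t ht).mono fun s hs => hs.1) rfl
  · obtain ⟨h1, h2⟩ := hNd ⌊t⌋₊ t ht fun hc => htN (mem_iUnion.2 ⟨_, hc⟩)
    rw [hvel _ t ht (hfloor t).le] at h1
    exact ⟨h1.congr_of_eventuallyEq ((hev t ht).mono fun s hs => hs.1) rfl,
      h2.congr_of_eventuallyEq ((hev t ht).mono fun s hs => hs.2) rfl⟩

/-- Well-posedness for operators `A(t) = D̃(t) A D(t)` with `A` maximal quasi-monotone. -/
theorem exists_unique_isSolution_of_conjugate {G : Set (H × H)} (hmax : IsMaximalQuasiMonotone G)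
    (hsv : ∀ x u v, (x, u) ∈ G → (x, v) ∈ G → u = v) {D Dt : ℝ → H →L[ℝ] H}
    (hD : ContDiffOn ℝ 1 D (Ici 0)) (hDlip : LocallyLipschitzInTime (derivWithin D (Ici 0)))
    (hDtlip : LocallyLipschitzInTime Dt)
    (hDinv : ∀ t, 0 ≤ t → (D t).IsInvertible) (hDtinv : ∀ t, 0 ≤ t → (Dt t).IsInvertible)
    (hsym : ∀ t, 0 ≤ t → ∀ x y, (inner ℝ (D t (Dt t x)) y : ℝ) = inner ℝ x (D t (Dt t y)))
    (hcoer : ∀ T : ℝ, 0 < T → ∃ c : ℝ, 0 < c ∧ ∀ t ∈ Icc 0 T, ∀ x,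
      c * ‖x‖ ^ 2 ≤ inner ℝ ((Dt t).inverse ((D t).inverse x)) x)
    {A : ℝ → Set (H × H)}
    (hA : ∀ t, 0 ≤ t → ∀ x v, (x, v) ∈ A t ↔ ∃ w, (D t x, w) ∈ G ∧ v = Dt t w)
    {x₀ : H} (hx₀ : x₀ ∈ operatorDomain (A 0)) :
    ∃ x : ℝ → H, IsSolution A x₀ x ∧ ∀ y : ℝ → H, IsSolution A x₀ y → EqOn y x (Ici 0) := by
  obtain ⟨ω, -, hGm⟩ := hmax
  -- The shift by `ω` makes the graph maximal monotone; `Q` below carries the compensating term `ω D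
  -- D̃`.
  set Gω : Set (H × H) := {p : H × H | (p.1, p.2 - ω • p.1) ∈ G} with hGω
  have hsvω : ∀ x u v, (x, u) ∈ Gω → (x, v) ∈ Gω → u = v := fun x u v hu hv =>
    sub_left_injective (hsv _ _ _ hu hv)
  have hmemω : ∀ x w, (x, w) ∈ G → (x, w + ω • x) ∈ Gω := by
    intro x w hw
    change (x, w + ω • x - ω • x) ∈ G
    rwa [add_sub_cancel_right]
  set D' := derivWithin D (Ici 0)
  have hDd : ∀ t, 0 ≤ t → HasDerivWithinAt D (D' t) (Ici 0) t := fun t ht =>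
    (hD.differentiableOn one_ne_zero t ht).hasDerivWithinAt
  set P : ℝ → H →L[ℝ] H := fun t => D t * Dt t
  set Q : ℝ → H →L[ℝ] H := fun t => D' t * (D t).inverse + ω • (D t * Dt t)
  set K : ℝ → H →L[ℝ] H := fun t => (Dt t).inverse * (D t).inverse
  have hKP : ∀ t, 0 ≤ t → ∀ x, K t (P t x) = x := by
    intro t ht x
    simp only [K, P, mul_apply_eq_comp, (hDinv t ht).inverse_apply_self,
      (hDtinv t ht).inverse_apply_self]
  have hPK : ∀ t, 0 ≤ t → ∀ x, P t (K t x) = x := by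
    intro t ht x
    simp only [K, P, mul_apply_eq_comp, (hDinv t ht).self_apply_inverse,
      (hDtinv t ht).self_apply_inverse]
  have hcoef : ∀ T, 0 < T → ∃ M c, EvolutionCoefficients (fun t => P (max 0 (min t T)))
      (fun t => Q (max 0 (min t T))) (fun t => K (max 0 (min t T))) M c := by
    intro T hT
    obtain ⟨c, hc, hcT⟩ := hcoer T hT
    obtain ⟨ν, hν, hν'⟩ := hDlip T hT
    obtain ⟨κ, hκ, hκ'⟩ := hDtlip T hT
    have b1 : BddLipschitzOn T D := BddLipschitzOn.of_contDiffOn hD T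
    have b2 : BddLipschitzOn T D' := BddLipschitzOn.of_lipschitz hν.le hν'
    have b3 : BddLipschitzOn T Dt := BddLipschitzOn.of_lipschitz hκ.le hκ'
    have b4 := b1.inverse fun t ht => hDinv t ht.1
    have b5 := b3.inverse fun t ht => hDtinv t ht.1
    obtain ⟨M, hM⟩ := exists_evolutionCoefficients_clamp hT.le hc (b1.mul b3)
      ((b2.mul b4).add ((b1.mul b3).const_smul ω)) (b5.mul b4)
      -- Symmetry of `K = P⁻¹` is that of `P = D D̃` evaluated at `K x` and `K y`.
      (fun t ht x y => by
        have := hsym t ht.1 (K t x) (K t y)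
        have e : ∀ w, D t (Dt t (K t w)) = w := hPK t ht.1
        rw [e, e] at this
        exact this.symm)
      (fun t ht x => hcT t ht x) (fun t ht x => hKP t ht.1 x)
    exact ⟨M, c, hM⟩
  -- Every solution is carried by `D` to a strong solution of the transformed equation, so
  -- uniqueness there, with injectivity of `D t`, gives uniqueness here.
  have hstrong : ∀ x, IsSolution A x₀ x → ∃ z : ℝ → H,
      ContinuousOn (fun t => D t (x t)) (Ici 0) ∧ (∀ t, 0 ≤ t → (D t (x t), z t) ∈ Gω) ∧
      ∃ N : Set ℝ, N.Countable ∧ ∀ t, 0 ≤ t → t ∉ N →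
        HasDerivWithinAt (fun t => D t (x t)) (velocity P Q t (D t (x t)) (z t)) (Ici 0) t := by
    rintro x ⟨hxc, -, v, hv, N, hN, hd⟩
    choose! w hw hvw using fun t ht => (hA t ht (x t) (v t)).1 (hv t ht)
    refine ⟨fun t => w t + ω • D t (x t), hD.continuousOn.clm_apply hxc,
      fun t ht => hmemω _ _ (hw t ht), N, hN, fun t ht htN => ?_⟩
    refine ((hDd t ht).clm_apply (hd t ht htN).1).congr_deriv ?_
    simp only [velocity, P, Q, add_apply, smul_apply, mul_apply_eq_comp, map_add, map_smul, map_neg,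
      (hDinv t ht).inverse_apply_self]
    rw [hvw t ht]
    abel
  obtain ⟨v₀, hv₀⟩ := hx₀
  obtain ⟨w₀, hw₀, -⟩ := (hA 0 le_rfl _ _).1 hv₀
  obtain ⟨y, z, hy0, hyc, hyz, N, hN, hyd⟩ :=
    exists_strongSolution hGm hsvω hcoef (hmemω _ _ hw₀)
  have hsol : IsSolution A x₀ fun t => (D t).inverse (y t) := by
    have hid : ∀ t, 0 ≤ t → HasDerivWithinAt (fun t => (D t).inverse)
        (-((D t).inverse * D' t * (D t).inverse)) (Ici 0) t := fun t ht =>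
      HasDerivWithinAt.clm_inverse (hDd t ht) ht fun r hr => hDinv r hr
    refine ⟨fun t ht => (hid t ht).continuousWithinAt.clm_apply (hyc t ht), ?_,
      fun t => Dt t (z t - ω • y t), fun t ht => ?_, N, hN, fun t ht htN => ⟨?_, ?_⟩⟩
    · simp only [hy0, (hDinv 0 le_rfl).inverse_apply_self]
    · refine (hA t ht _ _).2 ⟨z t - ω • y t, ?_, rfl⟩
      rw [(hDinv t ht).self_apply_inverse]
      exact hyz t ht
    -- The derivative `-D⁻¹ D' D⁻¹` of `D⁻¹` cancels the term `D' D⁻¹` of `Q`, and the two `ω` terms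
    -- combine into `-D̃ (z - ω y)`.
    · refine ((hid t ht).clm_apply (hyd t ht htN).1).congr_deriv ?_
      simp only [velocity, P, Q, add_apply, smul_apply, neg_apply, mul_apply_eq_comp, map_add,
        map_smul, map_sub, (hDinv t ht).inverse_apply_self]
      abel
    · obtain ⟨κ, hκ, hκ'⟩ := hDtlip (t + 1) (by linarith)
      have hc : ContinuousWithinAt Dt (Ici 0) t :=
        ((BddLipschitzOn.of_lipschitz hκ.le hκ').continuousOn t ⟨ht, by linarith⟩).mono_of_mem_nhdsWithin
          (inter_mem self_mem_nhdsWithin (nhdsWithin_le_nhds (Iic_mem_nhds (by linarith))))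
      exact hc.clm_apply ((hyd t ht htN).2.sub ((hyc t ht).const_smul ω))
  refine ⟨_, hsol, fun x hx t ht => ?_⟩
  obtain ⟨z₁, hc₁, hm₁, N₁, hN₁, hd₁⟩ := hstrong _ hx
  obtain ⟨z₂, hc₂, hm₂, N₂, hN₂, hd₂⟩ := hstrong _ hsol
  have ht0 : (0 : ℝ) ≤ t := ht
  obtain ⟨M, c, h⟩ := hcoef (t + 1) (by linarith)
  have hvel : ∀ s ∈ Ico 0 t, ∀ y z, velocity (fun t₁ => P (max 0 (min t₁ (t + 1))))
      (fun t₁ => Q (max 0 (min t₁ (t + 1)))) s y z = velocity P Q s y z := by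
    intro s hs y z
    simp only [velocity, min_eq_left (show s ≤ t + 1 by linarith [hs.2]), max_eq_right hs.1]
  have heq := h.eq_of_hasDerivWithinAt hGm.1 ht0 (hc₁.mono Icc_subset_Ici_self)
    (hc₂.mono Icc_subset_Ici_self) (by simp only [hx.2.1, hsol.2.1])
    (fun s hs => hm₁ s hs.1) (fun s hs => hm₂ s hs.1) (hN₁.union hN₂)
    (fun s hs hsN => by
      rw [hvel s hs]
      exact hd₁ s hs.1 fun hc => hsN (Or.inl hc))
    (fun s hs hsN => by
      rw [hvel s hs]
      exact hd₂ s hs.1 fun hc => hsN (Or.inr hc))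
  exact (hDinv t ht0).injective heq

end Conjugation

end HyperbolicFeedback
-- The feedback system as a conjugated evolution problem.
theorem mainTheorem5
    -- the Hilbert spaces, with `V` densely and continuously embedded into `H`
    {V H : Type*}
    [NormedAddCommGroup H] [InnerProductSpace ℝ H] [CompleteSpace H]
    [NormedAddCommGroup V] [InnerProductSpace ℝ V] [CompleteSpace V]
    (ι : V →L[ℝ] H) (hι : Function.Injective ι) (hιd : DenseRange ι)
    -- the control space `U = ∏ U_j`, with `U_j` closed in `L²(X_j, μ_j)^{N_j}`
    {J : ℕ} {X : Fin J → Type*} [∀ j, MeasurableSpace (X j)]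
    (μ : ∀ j, Measure (X j)) [∀ j, IsFiniteMeasure (μ j)] (N : Fin J → ℕ)
    (U : ∀ j, Submodule ℝ (Lp (EuclideanSpace ℝ (Fin (N j))) 2 (μ j)))
    (hU : ∀ j, IsClosed (U j : Set (Lp (EuclideanSpace ℝ (Fin (N j))) 2 (μ j))))
    (IU : V →L[ℝ] (∀ j, U j))
    -- the nonlinearities
    (g : ∀ j, EuclideanSpace ℝ (Fin (N j)) → EuclideanSpace ℝ (Fin (N j)))
    (hgc : ∀ j, Continuous (g j))
    (hgm : ∀ j x y, 0 ≤ inner ℝ (g j x - g j y) (x - y))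
    (hg0 : ∀ j, g j 0 = 0)
    (hgb : ∃ M : ℝ, 0 < M ∧ ∀ j x, ‖g j x‖ ≤ M * (1 + ‖x‖))
    -- the coefficients, which depend on time only and coincide
    (αj : ∀ j, ℝ → X j → ℝ) (α : ℝ → ℝ)
    (hαj : ∀ j t, 0 ≤ t → ∀ x, αj j t x = α t)
    (hα : ContDiffOn ℝ 1 α (Set.Ici 0)) (hαpos : ∀ t, 0 ≤ t → 0 < α t)
    (hαlip : LocallyLipschitzInTime (derivWithin α (Set.Ici 0)))
    -- the operator `A_1 : V → V'`
    (A₁ : V →L[ℝ] StrongDual ℝ V)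
    -- `A_1 + B_1` is maximal quasi-monotone with dense domain in `H`
    (hmax : IsMaximalQuasiMonotone
      (partInH ι (fun u v => A₁ u v + dampingPairing IU g (fun _ _ => 1) u v)))
    (hdense : Dense (operatorDomain
      (partInH ι (fun u v => A₁ u v + dampingPairing IU g (fun _ _ => 1) u v))))
    -- the operator families `D` and `D̃`
    (D Dt : ℝ → H →L[ℝ] H)
    (hD : ContDiffOn ℝ 1 D (Set.Ici 0))
    (hDlip : LocallyLipschitzInTime (derivWithin D (Set.Ici 0)))
    (hDtc : ContinuousOn Dt (Set.Ici 0)) (hDtlip : LocallyLipschitzInTime Dt)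
    (hDinv : ∀ t, 0 ≤ t → (D t).IsInvertible) (hDtinv : ∀ t, 0 ≤ t → (Dt t).IsInvertible)
    (hsym : ∀ t, 0 ≤ t → ∀ x y, inner ℝ (D t (Dt t x)) y = inner ℝ x (D t (Dt t y)))
    (hpos : ∀ t, 0 ≤ t → ∀ x, x ≠ 0 → 0 < inner ℝ (D t (Dt t x)) x)
    (hcoer : ∀ T : ℝ, 0 < T → ∃ c : ℝ, 0 < c ∧ ∀ t ∈ Set.Icc 0 T, ∀ x,
      c * ‖x‖ ^ 2 ≤ inner ℝ ((Dt t).inverse ((D t).inverse x)) x)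
    -- `(A_1 + α(t) B_1) D(t)⁻¹ = D̃(t) (A_1 + B_1)` as operators in `H`
    (hcomm : ∀ t, 0 ≤ t →
      {p : H × H | ((D t).inverse p.1, p.2) ∈
        partInH ι (fun u v => A₁ u v + α t * dampingPairing IU g (fun _ _ => 1) u v)} =
      {p : H × H | ∃ w : H, (p.1, w) ∈
        partInH ι (fun u v => A₁ u v + dampingPairing IU g (fun _ _ => 1) u v) ∧ p.2 = Dt t w})
    -- the initial datum lies in the domain of `A_1 + B(0)`
    (x₀ : H)
    (hx₀ : x₀ ∈ operatorDomain
      (partInH ι (fun u v => A₁ u v + dampingPairing IU g (fun j => αj j 0) u v))) :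
    ∃ x : ℝ → H,
      IsSolution
        (fun t => partInH ι (fun u v => A₁ u v + dampingPairing IU g (fun j => αj j t) u v)) x₀ x ∧
      ∀ y : ℝ → H,
        IsSolution
          (fun t => partInH ι (fun u v => A₁ u v + dampingPairing IU g (fun j => αj j t) u v))
          x₀ y →
        Set.EqOn y x (Set.Ici 0) := by 
  have hB : ∀ t, 0 ≤ t →
      (fun u v => A₁ u v + dampingPairing IU g (fun j => αj j t) u v) =
        fun u v => A₁ u v + α t * dampingPairing IU g (fun _ _ => 1) u v := by
    intro t ht
    funext u v
    simp only [dampingPairing, Finset.mul_sum]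
    congr 1
    refine Finset.sum_congr rfl fun j _ => ?_
    rw [← integral_const_mul]
    simp only [hαj j t ht, one_mul]
  refine exists_unique_isSolution_of_conjugate hmax
    (fun x u v hu hv => partInH_singleValued hι hιd hu hv) hD hDlip hDtlip hDinv hDtinv hsym hcoer
    (fun t ht x v => ?_) hx₀
  -- Evaluated at first component `D t x`, the commutation identity becomes the description of the
  -- operator at time `t` as `D̃(t) A D(t)`, domains included.
  have h1 := Set.ext_iff.1 (hcomm t ht) (D t x, v)
  simp only [mem_ofPred_eq, (hDinv t ht).inverse_apply_self] at h1
  rw [hB t ht]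
  exact h1
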